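/- A three-qubit state is a density matrix $\rho$ (pure or mixed: positive semidefinite, trace one) on $\mathbb{C}^2\otimes\mathbb{C}^2\otimes\mathbb{C}^2$, with the qubits labelled $A,B,C$; $\rho_{AB},\rho_{AC},\rho_{BC}$ denote its two-qubit reduced states. For a bipartite unit vector $\phi$ let $E(\phi)=-\sum_i\lambda_i\log_2\lambda_i$, where the $\lambda_i$ are the eigenvalues of the first marginal of $|\phi\rangle\langle\phi|$, and for a bipartite density matrix $\sigma$ let the entanglement of formation be $E(\sigma)=\inf\sum_i p_iE(\phi_i)$, the infimum (which is attained) running over all finite decompositions $\sigma=\sum_i p_i|\phi_i\rangle\langle\phi_i|$ into unit vectors $\phi_i$ with $p_i\ge 0$ and $\sum_i p_i=1$. Let $|W\rangle=\frac{1}{\sqrt3}(|001\rangle+|010\rangle+|100\rangle)$ and $h(x)=-x\log_2x-(1-x)\log_2(1-x)$. Theorem. The maximum of $E(\rho_{AB})+E(\rho_{AC})+E(\rho_{BC})$ over all three-qubit states $\rho$ exists and equals $c_{\max}=3h\left(\frac12+\frac{\sqrt5}{6}\right)$. A three-qubit state $\rho$ attains it if and only if $\rho$ is the W state up to local unitaries,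 that is, $\rho=(U_1\otimes U_2\otimes U_3)|W\rangle\langle W|(U_1\otimes U_2\otimes U_3)^\dagger$ for some $2\times2$ unitary matrices $U_1,U_2,U_3$. -/

import Mathlib

open scoped Kronecker Matrix ComplexOrder

noncomputable section

namespace ThreeQubit

/-- A density matrix: positive semidefinite with trace one. -/
def IsDensity {n : Type*} [Fintype n] (ρ : Matrix n n ℂ) : Prop :=
  ρ.PosSemidef ∧ ρ.trace = 1

/-- A normalized state vector, `⟨ψ|ψ⟩ = 1`. -/
def IsUnitKet {n : Type*} [Fintype n] (ψ : n → ℂ) : Prop :=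
  star ψ ⬝ᵥ ψ = 1

/-- The rank-one operator `|ψ⟩⟨ψ|`. -/
def ketbra {n : Type*} (ψ : n → ℂ) : Matrix n n ℂ :=
  Matrix.vecMulVec ψ (star ψ)

/-- Partial trace over the second factor of a bipartite system. -/
def traceSnd {m n : Type*} [Fintype n] (ρ : Matrix (m × n) (m × n) ℂ) : Matrix m m ℂ :=
  Matrix.of fun i j => ∑ k, ρ (i, k) (j, k)

theorem isHermitian_traceSnd_ketbra {m n : Type*} [Fintype n] (ψ : m × n → ℂ) :
    (traceSnd (ketbra ψ)).IsHermitian := by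
  ext i j
  simp [traceSnd, ketbra, Matrix.vecMulVec_apply, mul_comm]

/-- The von Neumann entropy `-∑ λ log₂ λ` over the eigenvalues `λ` of a Hermitian matrix,
counted with multiplicity (and `0 log₂ 0 = 0`). -/
def entropy {m : Type*} [Fintype m] [DecidableEq m] {A : Matrix m m ℂ} (hA : A.IsHermitian) : ℝ :=
  -∑ i, hA.eigenvalues i * Real.logb 2 (hA.eigenvalues i)

/-- Entanglement of formation of a bipartite pure state: the entropy of its first marginal. -/
def pureEoF {m n : Type*} [Fintype m] [DecidableEq m] [Fintype n] (ψ : m × n → ℂ) : ℝ :=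
  entropy (isHermitian_traceSnd_ketbra ψ)

/-- `ρ = ∑ pᵢ |φᵢ⟩⟨φᵢ|` is a finite decomposition of `ρ` into pure states. -/
def IsPureDecomposition {n : Type*} [Fintype n] (ρ : Matrix n n ℂ) {k : ℕ}
    (p : Fin k → ℝ) (φ : Fin k → n → ℂ) : Prop :=
  (∀ i, 0 ≤ p i) ∧ ∑ i, p i = 1 ∧ (∀ i, IsUnitKet (φ i)) ∧
    ρ = ∑ i, (p i : ℂ) • ketbra (φ i)

/-- Entanglement of formation of a bipartite mixed state, by the convex roof construction. -/
def EoF {m n : Type*} [Fintype m] [DecidableEq m] [Fintype n]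
    (ρ : Matrix (m × n) (m × n) ℂ) : ℝ :=
  sInf {e : ℝ | ∃ (k : ℕ) (p : Fin k → ℝ) (φ : Fin k → m × n → ℂ),
    IsPureDecomposition ρ p φ ∧ e = ∑ i, p i * pureEoF (φ i)}

/-- Computational basis labels of three qubits `A`, `B`, `C`. -/
abbrev Idx : Type := Fin 2 × Fin 2 × Fin 2

/-- The reduced state of `A` and `B`. -/
def redAB (ρ : Matrix Idx Idx ℂ) : Matrix (Fin 2 × Fin 2) (Fin 2 × Fin 2) ℂ :=
  Matrix.of fun x y => ∑ c, ρ (x.1, x.2, c) (y.1, y.2, c)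

/-- The reduced state of `A` and `C`. -/
def redAC (ρ : Matrix Idx Idx ℂ) : Matrix (Fin 2 × Fin 2) (Fin 2 × Fin 2) ℂ :=
  Matrix.of fun x y => ∑ b, ρ (x.1, b, x.2) (y.1, b, y.2)

/-- The reduced state of `B` and `C`. -/
def redBC (ρ : Matrix Idx Idx ℂ) : Matrix (Fin 2 × Fin 2) (Fin 2 × Fin 2) ℂ :=
  Matrix.of fun x y => ∑ a, ρ (a, x.1, x.2) (a, y.1, y.2)

/-- `E(ρ_AB) + E(ρ_AC) + E(ρ_BC)`. -/
def sumEoF (ρ : Matrix Idx Idx ℂ) : ℝ :=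
  EoF (redAB ρ) + EoF (redAC ρ) + EoF (redBC ρ)

/-- `|W⟩ = (|001⟩ + |010⟩ + |100⟩) / √3`. -/
def ketW : Idx → ℂ :=
  ((1 / Real.sqrt 3 : ℝ) : ℂ) •
    (Pi.single (0, 0, 1) 1 + Pi.single (0, 1, 0) 1 + Pi.single (1, 0, 0) 1)

/-- `σ = (U₁ ⊗ U₂ ⊗ U₃) ρ (U₁ ⊗ U₂ ⊗ U₃)†` for some single-qubit unitaries. -/
def LocalUnitaryEquiv (ρ σ : Matrix Idx Idx ℂ) : Prop :=
  ∃ U₁ U₂ U₃ : Matrix.unitaryGroup (Fin 2) ℂ,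
    σ = ((U₁ : Matrix (Fin 2) (Fin 2) ℂ) ⊗ₖ
          ((U₂ : Matrix (Fin 2) (Fin 2) ℂ) ⊗ₖ (U₃ : Matrix (Fin 2) (Fin 2) ℂ))) * ρ *
        ((U₁ : Matrix (Fin 2) (Fin 2) ℂ) ⊗ₖ
          ((U₂ : Matrix (Fin 2) (Fin 2) ℂ) ⊗ₖ (U₃ : Matrix (Fin 2) (Fin 2) ℂ)))ᴴ

/-- The binary entropy in bits. -/
def h (x : ℝ) : ℝ :=
  -x * Real.logb 2 x - (1 - x) * Real.logb 2 (1 - x)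

/-- The upper bound `3 h(1/2 + √5/6)`. -/
def cMax : ℝ := 3 * h (1 / 2 + Real.sqrt 5 / 6)

end ThreeQubit

end

noncomputable section

namespace ThreeQubit

/-! ### The entanglement of a pure state as a function of its concurrence -/

/-! For a two-qubit unit ket `φ` put `C = 2‖det2 φ‖`, its concurrence; its entanglement is then
`concEnt C`. Two properties of this function at `C = 2/3` suffice. It lies below its tangent in the
variable `C ^ 2` (`exists_concEnt_le`), which gives the upper bound, and above its tangent in the
variable `C` (`exists_le_concEnt`), which shows that the W state reaches it.

Upper bound. Local unitaries bring a pure state to a form with coefficients only at 000, 100, 101,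
110, 111 (`exists_canonical`). Each two-qubit reduction is then a sum of two projections, one of
them onto a product ket, and such a sum splits into kets of equal concurrence (`hasDecomp_pair`).
The three concurrences obtained have squares adding up to at most `4/3`, by an elementary inequality
whose equality case is the W state. The tangent in `C ^ 2` gives the bound `cMax`, and equality
forces W up to local unitaries (`exists_hasDecomp3`). A mixed state inherits the bound, because
decompositions of the summands add.

Attainment. The reduction of W has range spanned by `|00⟩` and `|01⟩ + |10⟩`. On this range the
concurrence equals `2 |φ₀₁|²`, so every decomposition has mean concurrence exactly `2/3`; the
tangent in `C` bounds its cost from below (`le_sum_of_decomposition_ketW`).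

Uniqueness. A maximizer of rank at least two would have two orthogonal eigenkets. Unitary mixing of
the two preserves the sum of their projections, so every ket of their plane must be of W type, since
otherwise a strictly cheaper decomposition appears. When the whole plane is of W type, the
determinant forms of its kets are so rigid that, with one ket moved to W, the other lives on 011,
101, 110 with equal moduli (`WPartner.structure`). An explicit decomposition of the AB reduction of
the pair is then strictly cheaper (`exists_hasDecomp_redAB_lt`).

All decompositions are handled with unnormalized kets, the cost being homogeneous in the squared
norm. This makes costs additive over sums of operators. -/

/-- The entanglement of a two-qubit pure state of concurrence `C`. -/
def concEnt (C : ℝ) : ℝ := h ((1 + Real.sqrt (1 - C ^ 2)) / 2)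

theorem h_eq_binEntropy (x : ℝ) : h x = Real.binEntropy x / Real.log 2 := by
  unfold h Real.binEntropy Real.logb
  rw [Real.log_inv, Real.log_inv]
  ring

theorem log_two_pos : 0 < Real.log 2 := Real.log_pos (by norm_num)

/-- The inverse hyperbolic tangent. -/
def arth (s : ℝ) : ℝ := (Real.log (1 + s) - Real.log (1 - s)) / 2

theorem hasDerivAt_arth {s : ℝ} (h0 : -1 < s) (h1 : s < 1) :
    HasDerivAt arth (1 / (1 - s ^ 2)) s := by
  have a : (1 + s) ≠ 0 := by linarith
  have b : (1 - s) ≠ 0 := by linarith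
  have e1 := ((hasDerivAt_id s).const_add 1).log a
  have e2 := ((hasDerivAt_id s).const_sub 1).log b
  have e3 := (e1.sub e2).div_const 2
  refine e3.congr_deriv ?_
  have c : 1 - s ^ 2 ≠ 0 := by
    have : 1 - s ^ 2 = (1 + s) * (1 - s) := by ring
    rw [this]; exact mul_ne_zero a b
  simp only [id]
  field_simp
  ring

theorem arth_zero : arth 0 = 0 := by simp [arth]

theorem hasDerivAt_entropy_half {s : ℝ} (h0 : -1 < s) (h1 : s < 1) :
    HasDerivAt (fun s => Real.binEntropy ((1 + s) / 2)) (-arth s) s := by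
  have e0 : HasDerivAt (fun s : ℝ => (1 + s) / 2) (1 / 2) s :=
    ((hasDerivAt_id s).const_add 1).div_const 2
  have e1 : HasDerivAt Real.binEntropy _ ((1 + s) / 2) :=
    Real.hasDerivAt_binEntropy (by linarith) (by linarith)
  refine (e1.comp s e0).congr_deriv ?_
  have : 1 - (1 + s) / 2 = (1 - s) / 2 := by ring
  rw [this, Real.log_div (by linarith) (by norm_num), Real.log_div (by linarith) (by norm_num),
    arth]
  ring

theorem continuous_entropy_half : Continuous fun s : ℝ => Real.binEntropy ((1 + s) / 2) :=
  Real.binEntropy_continuous.comp (by fun_prop)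

theorem le_arth {s : ℝ} (h0 : 0 ≤ s) (h1 : s < 1) : s ≤ arth s := by
  have key : MonotoneOn (fun s => arth s - s) (Set.Ico 0 1) := by
    apply monotoneOn_of_hasDerivWithinAt_nonneg (f' := fun s => 1 / (1 - s ^ 2) - 1)
      (convex_Ico 0 1)
    · intro x hx
      exact ((hasDerivAt_arth (by linarith [hx.1]) hx.2).sub
        (hasDerivAt_id x)).continuousAt.continuousWithinAt
    · intro x hx
      rw [interior_Ico] at hx
      exact ((hasDerivAt_arth (by linarith [hx.1]) hx.2).sub (hasDerivAt_id x)).hasDerivWithinAt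
    · intro x hx
      rw [interior_Ico] at hx
      have : 0 < 1 - x ^ 2 := by nlinarith [hx.1, hx.2]
      rw [sub_nonneg, le_div_iff₀ this]
      nlinarith [sq_nonneg x]
  have := key (Set.left_mem_Ico.2 one_pos) ⟨h0, h1⟩ h0
  simp only [arth_zero] at this
  linarith

/-- This is the sign of the derivative of `arth s / s`; the companion bound `le_arth` is the sign
for `√(1 - s²) * arth s / s`. -/
theorem arth_le {s : ℝ} (h0 : 0 ≤ s) (h1 : s < 1) : arth s ≤ s / (1 - s ^ 2) := by
  have hd : ∀ x : ℝ, 0 ≤ x → x < 1 →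
      HasDerivAt (fun s => s / (1 - s ^ 2) - arth s) (2 * x ^ 2 / (1 - x ^ 2) ^ 2) x := by
    intro x hx hx1
    have c : 1 - x ^ 2 ≠ 0 := by nlinarith
    refine (((hasDerivAt_id x).div (((hasDerivAt_id x).pow 2).const_sub 1) c).sub
      (hasDerivAt_arth (by linarith) hx1)).congr_deriv ?_
    simp only [id, Pi.pow_apply]
    field_simp
    ring
  have key : MonotoneOn (fun s => s / (1 - s ^ 2) - arth s) (Set.Ico 0 1) := by
    apply monotoneOn_of_hasDerivWithinAt_nonneg (f' := fun x => 2 * x ^ 2 / (1 - x ^ 2) ^ 2)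
      (convex_Ico 0 1)
    · intro x hx
      exact (hd x hx.1 hx.2).continuousAt.continuousWithinAt
    · intro x hx
      rw [interior_Ico] at hx
      exact (hd x hx.1.le hx.2).hasDerivWithinAt
    · intro x hx
      positivity
  have := key (Set.left_mem_Ico.2 one_pos) ⟨h0, h1⟩ h0
  simp only [arth_zero] at this
  norm_num at this
  linarith

/-- Up to the factor `-1/2`, `arth s / s` is the derivative of the binary entropy at `(1 + s)/2`
with respect to `s²`. Its monotonicity is concavity in `s² = 1 - C²`. -/
theorem monotoneOn_arth_div : MonotoneOn (fun s => arth s / s) (Set.Ioo 0 1) := by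
  have hd : ∀ x : ℝ, x ∈ Set.Ioo (0 : ℝ) 1 →
      HasDerivAt (fun s => arth s / s) ((1 / (1 - x ^ 2) * x - arth x) / x ^ 2) x := by
    intro x hx
    refine ((hasDerivAt_arth (by linarith [hx.1]) hx.2).div (hasDerivAt_id x)
      hx.1.ne').congr_deriv ?_
    simp
  apply monotoneOn_of_hasDerivWithinAt_nonneg
    (f' := fun x => (1 / (1 - x ^ 2) * x - arth x) / x ^ 2) (convex_Ioo 0 1)
  · intro x hx
    exact (hd x hx).continuousAt.continuousWithinAt
  · intro x hx
    rw [interior_Ioo] at hx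
    exact (hd x hx).hasDerivWithinAt
  · intro x hx
    rw [interior_Ioo] at hx
    have := arth_le hx.1.le hx.2
    apply div_nonneg _ (sq_nonneg x)
    rw [one_div_mul_eq_div]
    linarith

/-- The function is the derivative of the same entropy with respect to `C = √(1 - s²)`. It decreases
in `s`, hence increases in `C`, which is convexity in the concurrence. -/
theorem antitoneOn_sqrt_mul_arth_div :
    AntitoneOn (fun s => Real.sqrt (1 - s ^ 2) * (arth s / s)) (Set.Ioo 0 1) := by
  have hd : ∀ x : ℝ, x ∈ Set.Ioo (0 : ℝ) 1 →
      HasDerivAt (fun s => Real.sqrt (1 - s ^ 2) * (arth s / s))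
        ((x - arth x) / (x ^ 2 * Real.sqrt (1 - x ^ 2))) x := by
    intro x hx
    have c : 0 < 1 - x ^ 2 := by nlinarith [hx.1, hx.2]
    have hx0 := hx.1.ne'
    refine (((((hasDerivAt_id x).pow 2).const_sub 1).sqrt c.ne').mul
      ((hasDerivAt_arth (by linarith [hx.1]) hx.2).div (hasDerivAt_id x)
      hx.1.ne')).congr_deriv ?_
    have hs : Real.sqrt (1 - x ^ 2) ≠ 0 := (Real.sqrt_pos.2 c).ne'
    have hsq : Real.sqrt (1 - x ^ 2) ^ 2 = 1 - x ^ 2 := Real.sq_sqrt c.le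
    simp only [Pi.pow_apply, Pi.div_apply, id, Nat.cast_ofNat]
    generalize Real.sqrt (1 - x ^ 2) = r at hs hsq
    rw [← hsq]
    field_simp
    linear_combination (-arth x) * hsq
  apply antitoneOn_of_hasDerivWithinAt_nonpos
    (f' := fun x => (x - arth x) / (x ^ 2 * Real.sqrt (1 - x ^ 2))) (convex_Ioo 0 1)
  · intro x hx
    exact (hd x hx).continuousAt.continuousWithinAt
  · intro x hx
    rw [interior_Ioo] at hx
    exact (hd x hx).hasDerivWithinAt
  · intro x hx
    rw [interior_Ioo] at hx
    have := le_arth hx.1.le hx.2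
    exact div_nonpos_of_nonpos_of_nonneg (by linarith) (by positivity)

/-- The binary entropy lies below its tangent parabola. -/
theorem entropy_half_le {s₀ s : ℝ} (h₀ : s₀ ∈ Set.Ioo (0 : ℝ) 1) (hs : s ∈ Set.Icc (0 : ℝ) 1) :
    Real.binEntropy ((1 + s) / 2) ≤
      Real.binEntropy ((1 + s₀) / 2) + arth s₀ / s₀ / 2 * (s₀ ^ 2 - s ^ 2) := by
  set K := arth s₀ / s₀ with hK
  have hc : Continuous fun s : ℝ => Real.binEntropy ((1 + s) / 2) + K / 2 * s ^ 2 :=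
    continuous_entropy_half.add (by fun_prop)
  have hd : ∀ x : ℝ, x ∈ Set.Ioo (0 : ℝ) 1 →
      HasDerivAt (fun s => Real.binEntropy ((1 + s) / 2) + K / 2 * s ^ 2)
        (x * (K - arth x / x)) x := by
    intro x hx
    have hx0 := hx.1.ne'
    refine ((hasDerivAt_entropy_half (by linarith [hx.1]) hx.2).add
      (((hasDerivAt_id x).pow 2).const_mul (K / 2))).congr_deriv ?_
    simp only [id]
    field_simp
    norm_num
    ring
  -- The derivative `x * (K - arth x / x)` passes from nonnegative to nonpositive at `s₀`, so the
  -- function is largest there.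
  rcases le_total s s₀ with hle | hle
  · have : MonotoneOn (fun s => Real.binEntropy ((1 + s) / 2) + K / 2 * s ^ 2)
        (Set.Icc 0 s₀) := by
      apply monotoneOn_of_hasDerivWithinAt_nonneg (f' := fun x => x * (K - arth x / x))
        (convex_Icc 0 s₀) hc.continuousOn
      · intro x hx
        rw [interior_Icc] at hx
        exact (hd x ⟨hx.1, hx.2.trans h₀.2⟩).hasDerivWithinAt
      · intro x hx
        rw [interior_Icc] at hx
        have := monotoneOn_arth_div ⟨hx.1, hx.2.trans h₀.2⟩ h₀ hx.2.le
        simp only at this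
        exact mul_nonneg hx.1.le (by linarith)
    have := this ⟨hs.1, hle⟩ ⟨h₀.1.le, le_rfl⟩ hle
    simp only at this
    linarith
  · have : AntitoneOn (fun s => Real.binEntropy ((1 + s) / 2) + K / 2 * s ^ 2)
        (Set.Icc s₀ 1) := by
      apply antitoneOn_of_hasDerivWithinAt_nonpos (f' := fun x => x * (K - arth x / x))
        (convex_Icc s₀ 1) hc.continuousOn
      · intro x hx
        rw [interior_Icc] at hx
        exact (hd x ⟨h₀.1.trans hx.1, hx.2⟩).hasDerivWithinAt
      · intro x hx
        rw [interior_Icc] at hx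
        have := monotoneOn_arth_div h₀ ⟨h₀.1.trans hx.1, hx.2⟩ hx.1.le
        simp only at this
        exact mul_nonpos_of_nonneg_of_nonpos (h₀.1.trans hx.1).le (by linarith)
    have := this ⟨le_rfl, h₀.2.le⟩ ⟨hle, hs.2⟩ hle
    simp only at this
    linarith

/-- The binary entropy lies above its tangent line in the variable `√(1 - s²)`. -/
theorem le_entropy_half {s₀ s : ℝ} (h₀ : s₀ ∈ Set.Ioo (0 : ℝ) 1) (hs : s ∈ Set.Icc (0 : ℝ) 1) :
    Real.binEntropy ((1 + s₀) / 2) + Real.sqrt (1 - s₀ ^ 2) * (arth s₀ / s₀) *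
        (Real.sqrt (1 - s ^ 2) - Real.sqrt (1 - s₀ ^ 2)) ≤
      Real.binEntropy ((1 + s) / 2) := by
  set K := Real.sqrt (1 - s₀ ^ 2) * (arth s₀ / s₀) with hK
  have hc : Continuous fun s : ℝ => Real.binEntropy ((1 + s) / 2) - K * Real.sqrt (1 - s ^ 2) :=
    continuous_entropy_half.sub (by fun_prop)
  have hd : ∀ x : ℝ, x ∈ Set.Ioo (0 : ℝ) 1 →
      HasDerivAt (fun s => Real.binEntropy ((1 + s) / 2) - K * Real.sqrt (1 - s ^ 2))
        (x / Real.sqrt (1 - x ^ 2) * (K - Real.sqrt (1 - x ^ 2) * (arth x / x))) x := by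
    intro x hx
    have hx0 := hx.1.ne'
    have c : 0 < 1 - x ^ 2 := by nlinarith [hx.1, hx.2]
    have hs : Real.sqrt (1 - x ^ 2) ≠ 0 := (Real.sqrt_pos.2 c).ne'
    refine ((hasDerivAt_entropy_half (by linarith [hx.1]) hx.2).sub
      (((((hasDerivAt_id x).pow 2).const_sub 1).sqrt c.ne').const_mul K)).congr_deriv ?_
    simp only [id, Pi.pow_apply]
    field_simp
    norm_num
    ring
  -- Here the derivative passes from nonpositive to nonnegative at `s₀`, which is a minimum.
  rcases le_total s s₀ with hle | hle
  · have : AntitoneOn (fun s => Real.binEntropy ((1 + s) / 2) - K * Real.sqrt (1 - s ^ 2))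
        (Set.Icc 0 s₀) := by
      apply antitoneOn_of_hasDerivWithinAt_nonpos (f' := fun x =>
        x / Real.sqrt (1 - x ^ 2) * (K - Real.sqrt (1 - x ^ 2) * (arth x / x)))
        (convex_Icc 0 s₀) hc.continuousOn
      · intro x hx
        rw [interior_Icc] at hx
        exact (hd x ⟨hx.1, hx.2.trans h₀.2⟩).hasDerivWithinAt
      · intro x hx
        rw [interior_Icc] at hx
        have := antitoneOn_sqrt_mul_arth_div ⟨hx.1, hx.2.trans h₀.2⟩ h₀ hx.2.le
        simp only at this
        exact mul_nonpos_of_nonneg_of_nonpos (div_nonneg hx.1.le (Real.sqrt_nonneg _))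
          (by linarith)
    have := this ⟨hs.1, hle⟩ ⟨h₀.1.le, le_rfl⟩ hle
    simp only at this
    linarith
  · have : MonotoneOn (fun s => Real.binEntropy ((1 + s) / 2) - K * Real.sqrt (1 - s ^ 2))
        (Set.Icc s₀ 1) := by
      apply monotoneOn_of_hasDerivWithinAt_nonneg (f' := fun x =>
        x / Real.sqrt (1 - x ^ 2) * (K - Real.sqrt (1 - x ^ 2) * (arth x / x)))
        (convex_Icc s₀ 1) hc.continuousOn
      · intro x hx
        rw [interior_Icc] at hx
        exact (hd x ⟨h₀.1.trans hx.1, hx.2⟩).hasDerivWithinAt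
      · intro x hx
        rw [interior_Icc] at hx
        have := antitoneOn_sqrt_mul_arth_div h₀ ⟨h₀.1.trans hx.1, hx.2⟩ hx.1.le
        simp only at this
        exact mul_nonneg (div_nonneg (h₀.1.trans hx.1).le (Real.sqrt_nonneg _)) (by linarith)
    have := this ⟨le_rfl, h₀.2.le⟩ ⟨hle, hs.2⟩ hle
    simp only at this
    linarith

theorem sqrt_one_sub_sq_mem {C : ℝ} : Real.sqrt (1 - C ^ 2) ∈ Set.Icc (0 : ℝ) 1 :=
  ⟨Real.sqrt_nonneg _, Real.sqrt_le_one.2 (by nlinarith [sq_nonneg C])⟩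

theorem sqrt_one_sub_sq_mem_Ioo : Real.sqrt (1 - (2 / 3) ^ 2) ∈ Set.Ioo (0 : ℝ) 1 :=
  ⟨Real.sqrt_pos.2 (by norm_num), (Real.sqrt_lt' one_pos).2 (by norm_num)⟩

theorem concEnt_nonneg (C : ℝ) : 0 ≤ concEnt C := by
  have := @sqrt_one_sub_sq_mem C
  rw [concEnt, h_eq_binEntropy]
  exact div_nonneg (Real.binEntropy_nonneg (by linarith [this.1]) (by linarith [this.2]))
    log_two_pos.le

theorem cMax_eq : cMax = 3 * concEnt (2 / 3) := by
  rw [cMax, concEnt]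
  have : Real.sqrt (1 - (2 / 3) ^ 2) = Real.sqrt 5 / 3 := by
    rw [show (1 - (2 / 3) ^ 2 : ℝ) = 5 / 3 ^ 2 by norm_num, Real.sqrt_div (by norm_num),
      Real.sqrt_sq (by norm_num)]
  rw [this]
  congr 2
  ring

/-- Concavity of the entanglement in the squared concurrence, at concurrence `2 / 3`. -/
theorem exists_concEnt_le : ∃ k : ℝ, 0 < k ∧ ∀ C : ℝ, 0 ≤ C → C ≤ 1 →
    concEnt C ≤ concEnt (2 / 3) + k * (C ^ 2 - 4 / 9) := by
  have h0 := sqrt_one_sub_sq_mem_Ioo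
  set s₀ := Real.sqrt (1 - (2 / 3) ^ 2) with hs₀
  have hs2 : s₀ ^ 2 = 1 - (2 / 3) ^ 2 := Real.sq_sqrt (by norm_num)
  have hpos : 0 < arth s₀ := lt_of_lt_of_le h0.1 (le_arth h0.1.le h0.2)
  -- The tangent slope, converted from nats to bits; `s₀² - s²` equals `C² - 4/9`.
  refine ⟨arth s₀ / s₀ / 2 / Real.log 2,
    div_pos (half_pos (div_pos hpos h0.1)) log_two_pos, fun C hC hC1 => ?_⟩
  have hsq : Real.sqrt (1 - C ^ 2) ^ 2 = 1 - C ^ 2 := Real.sq_sqrt (by nlinarith)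
  have := entropy_half_le h0 (@sqrt_one_sub_sq_mem C)
  rw [hs2, hsq] at this
  rw [concEnt, concEnt, h_eq_binEntropy, h_eq_binEntropy, ← hs₀, div_mul_eq_mul_div,
    ← add_div]
  apply div_le_div_of_nonneg_right _ log_two_pos.le
  linarith

/-- Convexity of the entanglement in the concurrence, at concurrence `2 / 3`. -/
theorem exists_le_concEnt : ∃ k : ℝ, ∀ C : ℝ, 0 ≤ C → C ≤ 1 →
    concEnt (2 / 3) + k * (C - 2 / 3) ≤ concEnt C := by
  have h0 := sqrt_one_sub_sq_mem_Ioo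
  set s₀ := Real.sqrt (1 - (2 / 3) ^ 2) with hs₀
  have hs2 : s₀ ^ 2 = 1 - (2 / 3) ^ 2 := Real.sq_sqrt (by norm_num)
  refine ⟨Real.sqrt (1 - s₀ ^ 2) * (arth s₀ / s₀) / Real.log 2, fun C hC hC1 => ?_⟩
  have hsq : Real.sqrt (1 - C ^ 2) ^ 2 = 1 - C ^ 2 := Real.sq_sqrt (by nlinarith)
  have := le_entropy_half h0 (@sqrt_one_sub_sq_mem C)
  rw [hs2, hsq, sub_sub_cancel, sub_sub_cancel, Real.sqrt_sq hC,
    Real.sqrt_sq (by norm_num : (0 : ℝ) ≤ 2 / 3)] at this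
  rw [concEnt, concEnt, h_eq_binEntropy, h_eq_binEntropy, ← hs₀, div_mul_eq_mul_div,
    ← add_div]
  apply div_le_div_of_nonneg_right _ log_two_pos.le
  rw [hs2, sub_sub_cancel, Real.sqrt_sq (by norm_num : (0 : ℝ) ≤ 2 / 3)]
  exact this

theorem concEnt_lt {C : ℝ} (hC : 0 ≤ C) (hC' : C < 2 / 3) : concEnt C < concEnt (2 / 3) := by
  obtain ⟨k, hk, H⟩ := exists_concEnt_le
  have := H C hC (by linarith)
  have : k * (C ^ 2 - 4 / 9) < 0 := mul_neg_of_pos_of_neg hk (by nlinarith)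
  linarith

/-! ### Unnormalized kets -/

/-- The squared norm of a ket. -/
def nsq {n : Type*} [Fintype n] (v : n → ℂ) : ℝ := ∑ i, Complex.normSq (v i)

section nsq

variable {n : Type*} [Fintype n]

theorem nsq_nonneg (v : n → ℂ) : 0 ≤ nsq v := Finset.sum_nonneg fun _ _ => Complex.normSq_nonneg _

theorem nsq_eq_zero {v : n → ℂ} : nsq v = 0 ↔ v = 0 := by
  rw [nsq, Finset.sum_eq_zero_iff_of_nonneg fun _ _ => Complex.normSq_nonneg _]
  simp [funext_iff]

theorem nsq_smul (c : ℂ) (v : n → ℂ) : nsq (c • v) = Complex.normSq c * nsq v := by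
  simp [nsq, Finset.mul_sum]

theorem star_dotProduct_self (v : n → ℂ) : star v ⬝ᵥ v = (nsq v : ℂ) := by
  simp [dotProduct, nsq, Complex.normSq_eq_conj_mul_self]

theorem isUnitKet_iff {v : n → ℂ} : IsUnitKet v ↔ nsq v = 1 := by
  rw [IsUnitKet, star_dotProduct_self]
  norm_cast

theorem trace_ketbra (v : n → ℂ) : (ketbra v).trace = (nsq v : ℂ) := by
  rw [ketbra, Matrix.trace_vecMulVec, dotProduct_comm, star_dotProduct_self]

theorem ketbra_smul (c : ℂ) (v : n → ℂ) :
    ketbra (c • v) = (Complex.normSq c : ℂ) • ketbra v := by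
  ext i j
  simp [ketbra, Matrix.vecMulVec_apply, Complex.normSq_eq_conj_mul_self]
  ring

theorem ketbra_mulVec (M : Matrix n n ℂ) (v : n → ℂ) :
    ketbra (M *ᵥ v) = M * ketbra v * Mᴴ := by
  rw [ketbra, ketbra, Matrix.mul_vecMulVec, Matrix.vecMulVec_mul, Matrix.star_mulVec]

theorem nsq_mulVec [DecidableEq n] {M : Matrix n n ℂ} (hM : Mᴴ * M = 1) (v : n → ℂ) :
    nsq (M *ᵥ v) = nsq v := by
  have : star (M *ᵥ v) ⬝ᵥ (M *ᵥ v) = star v ⬝ᵥ v := by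
    rw [Matrix.star_mulVec, Matrix.dotProduct_mulVec, Matrix.vecMul_vecMul, hM, Matrix.vecMul_one]
  rw [star_dotProduct_self, star_dotProduct_self] at this
  exact_mod_cast this

/-- Mixing two kets by a unitary matrix does not change the sum of their projections. -/
theorem ketbra_add_ketbra_mix {n : Type*} (U : Matrix.unitaryGroup (Fin 2) ℂ) (v : Fin 2 → n → ℂ) :
    ketbra (U 0 0 • v 0 + U 0 1 • v 1) + ketbra (U 1 0 • v 0 + U 1 1 • v 1) =
      ketbra (v 0) + ketbra (v 1) := by
  have hU : star (U : Matrix (Fin 2) (Fin 2) ℂ) * U = 1 := Matrix.UnitaryGroup.star_mul_self U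
  have h00 := congrFun (congrFun hU 0) 0
  have h01 := congrFun (congrFun hU 0) 1
  have h10 := congrFun (congrFun hU 1) 0
  have h11 := congrFun (congrFun hU 1) 1
  simp [Matrix.mul_apply, Matrix.star_apply] at h00 h01 h10 h11
  ext i j
  simp [ketbra, Matrix.vecMulVec_apply]
  linear_combination (v 0 i * starRingEnd ℂ (v 0 j)) * h00 +
    (v 1 i * starRingEnd ℂ (v 0 j)) * h01 + (v 0 i * starRingEnd ℂ (v 1 j)) * h10 +
    (v 1 i * starRingEnd ℂ (v 1 j)) * h11

end nsq

/-- The unitary matrix with first row `(x, y)`. -/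
def rowUnitary (x y : ℂ) (hxy : Complex.normSq x + Complex.normSq y = 1) :
    Matrix.unitaryGroup (Fin 2) ℂ :=
  ⟨!![x, y; -starRingEnd ℂ y, starRingEnd ℂ x], by
    have : x * starRingEnd ℂ x + y * starRingEnd ℂ y = 1 := by
      rw [Complex.mul_conj, Complex.mul_conj]
      exact_mod_cast hxy
    rw [Matrix.mem_unitaryGroup_iff]
    ext i j
    fin_cases i <;> fin_cases j <;>
      simp [Matrix.mul_apply, Matrix.star_apply] <;> first | linear_combination this | ring⟩

/-! ### Decompositions of two-qubit operators -/

/-- A ket of two qubits. -/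
abbrev Ket2 : Type := Fin 2 × Fin 2 → ℂ

/-- Half of the preconcurrence of a ket of two qubits. -/
def det2 (v : Ket2) : ℂ := v (0, 0) * v (1, 1) - v (0, 1) * v (1, 0)

theorem nsq_ket2 (v : Ket2) : nsq v = Complex.normSq (v (0, 0)) + Complex.normSq (v (0, 1)) +
    Complex.normSq (v (1, 0)) + Complex.normSq (v (1, 1)) := by
  rw [nsq, Fintype.sum_prod_type]
  simp [Fin.sum_univ_two]
  ring

theorem det2_smul (c : ℂ) (v : Ket2) : det2 (c • v) = c ^ 2 * det2 v := by
  simp [det2]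
  ring

theorem kronecker_mulVec_apply (U V : Matrix (Fin 2) (Fin 2) ℂ) (v : Ket2) (i j : Fin 2) :
    ((U ⊗ₖ V) *ᵥ v) (i, j) = U i 0 * V j 0 * v (0, 0) + U i 0 * V j 1 * v (0, 1) +
      U i 1 * V j 0 * v (1, 0) + U i 1 * V j 1 * v (1, 1) := by
  simp [Matrix.mulVec, dotProduct, Fintype.sum_prod_type, Fin.sum_univ_two,
    Matrix.kroneckerMap_apply]
  ring

theorem det2_kronecker_mulVec (U V : Matrix (Fin 2) (Fin 2) ℂ) (v : Ket2) :
    det2 ((U ⊗ₖ V) *ᵥ v) = U.det * V.det * det2 v := by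
  simp only [det2, kronecker_mulVec_apply, Matrix.det_fin_two]
  ring

theorem norm_det2_kronecker_mulVec (U V : Matrix.unitaryGroup (Fin 2) ℂ) (v : Ket2) :
    ‖det2 (((U : Matrix (Fin 2) (Fin 2) ℂ) ⊗ₖ (V : Matrix (Fin 2) (Fin 2) ℂ)) *ᵥ v)‖ =
      ‖det2 v‖ := by
  have key : ∀ U : Matrix.unitaryGroup (Fin 2) ℂ, ‖(U : Matrix (Fin 2) (Fin 2) ℂ).det‖ = 1 :=
    fun U => CStarRing.norm_of_mem_unitary (Matrix.det_of_mem_unitary U.2)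
  rw [det2_kronecker_mulVec, norm_mul, norm_mul, key, key]
  simp

theorem conjTranspose_kronecker_mul_self (U V : Matrix.unitaryGroup (Fin 2) ℂ) :
    ((U : Matrix (Fin 2) (Fin 2) ℂ) ⊗ₖ (V : Matrix (Fin 2) (Fin 2) ℂ))ᴴ *
      ((U : Matrix (Fin 2) (Fin 2) ℂ) ⊗ₖ (V : Matrix (Fin 2) (Fin 2) ℂ)) = 1 := by
  have hU : (U : Matrix (Fin 2) (Fin 2) ℂ)ᴴ * U = 1 := Matrix.UnitaryGroup.star_mul_self U
  have hV : (V : Matrix (Fin 2) (Fin 2) ℂ)ᴴ * V = 1 := Matrix.UnitaryGroup.star_mul_self V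
  rw [Matrix.conjTranspose_kronecker, ← Matrix.mul_kronecker_mul, hU, hV, Matrix.one_kronecker_one]

theorem nsq_kronecker_mulVec (U V : Matrix.unitaryGroup (Fin 2) ℂ) (v : Ket2) :
    nsq (((U : Matrix (Fin 2) (Fin 2) ℂ) ⊗ₖ (V : Matrix (Fin 2) (Fin 2) ℂ)) *ᵥ v) = nsq v :=
  nsq_mulVec (conjTranspose_kronecker_mul_self U V) v

/-- The entanglement of an unnormalized ket, weighted by its squared norm. -/
def cost (v : Ket2) : ℝ := nsq v * concEnt (2 * ‖det2 v‖ / nsq v)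

/-- The proportionality is written without division so that a zero ket, whose cost is zero anyway,
is covered. -/
theorem cost_of_mul_eq {v : Ket2} {N δ : ℝ} (hN : 0 < N) (h : N * ‖det2 v‖ = δ * nsq v) :
    cost v = nsq v * concEnt (2 * δ / N) := by
  rcases eq_or_ne (nsq v) 0 with h0 | h0
  · simp [cost, h0]
  · rw [cost]
    congr 2
    field_simp
    linarith

/-- `σ` is a sum of unnormalized projections of total cost at most `e`. -/
def HasDecomp (σ : Matrix (Fin 2 × Fin 2) (Fin 2 × Fin 2) ℂ) (e : ℝ) : Prop :=
  ∃ l : List Ket2, σ = (l.map ketbra).sum ∧ (l.map cost).sum ≤ e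

namespace HasDecomp

variable {σ τ : Matrix (Fin 2 × Fin 2) (Fin 2 × Fin 2) ℂ} {e f : ℝ}

theorem zero : HasDecomp 0 0 := ⟨[], by simp, by simp⟩

theorem add (hσ : HasDecomp σ e) (hτ : HasDecomp τ f) : HasDecomp (σ + τ) (e + f) := by
  obtain ⟨l, rfl, hl⟩ := hσ
  obtain ⟨m, rfl, hm⟩ := hτ
  exact ⟨l ++ m, by simp, by simpa using add_le_add hl hm⟩

theorem single (v : Ket2) : HasDecomp (ketbra v) (cost v) := ⟨[v], by simp, by simp⟩

theorem conj (U V : Matrix.unitaryGroup (Fin 2) ℂ) (hσ : HasDecomp σ e) :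
    HasDecomp (((U : Matrix (Fin 2) (Fin 2) ℂ) ⊗ₖ (V : Matrix (Fin 2) (Fin 2) ℂ)) * σ *
      ((U : Matrix (Fin 2) (Fin 2) ℂ) ⊗ₖ (V : Matrix (Fin 2) (Fin 2) ℂ))ᴴ) e := by
  obtain ⟨l, rfl, hl⟩ := hσ
  set M := (U : Matrix (Fin 2) (Fin 2) ℂ) ⊗ₖ (V : Matrix (Fin 2) (Fin 2) ℂ) with hM
  refine ⟨l.map (M *ᵥ ·), ?_, ?_⟩
  · clear hl
    induction l with
    | nil => simp
    | cons v l ih =>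
      rw [List.map_cons, List.sum_cons, mul_add, add_mul, ih, ← ketbra_mulVec]
      rfl
  · rw [List.map_map]
    convert hl using 3
    ext v
    simp only [Function.comp, cost, hM, nsq_kronecker_mulVec, norm_det2_kronecker_mulVec]

end HasDecomp

/-! ### The entanglement of formation of two qubits -/

theorem traceSnd_ketbra_trace (φ : Ket2) : (traceSnd (ketbra φ)).trace = (nsq φ : ℂ) := by
  simp [Matrix.trace, traceSnd, ketbra, Matrix.vecMulVec_apply, nsq_ket2, Complex.mul_conj]
  ring

theorem traceSnd_ketbra_det (φ : Ket2) :
    (traceSnd (ketbra φ)).det = (Complex.normSq (det2 φ) : ℂ) := by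
  rw [Matrix.det_fin_two, ← Complex.mul_conj]
  simp [traceSnd, ketbra, Matrix.vecMulVec_apply, det2]
  ring

theorem h_one_sub (x : ℝ) : h (1 - x) = h x := by
  unfold h
  rw [sub_sub_cancel]
  ring

/-- The two eigenvalues of the marginal have sum 1 and product `‖det2 φ‖²`, so they are `(1 ± √(1 -
C²))/2`; the symmetry of `h` makes their order irrelevant. -/
theorem pureEoF_eq {φ : Ket2} (hφ : IsUnitKet φ) : pureEoF φ = concEnt (2 * ‖det2 φ‖) := by
  have hA := isHermitian_traceSnd_ketbra φ
  have ht := hA.trace_eq_sum_eigenvalues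
  have hd := hA.det_eq_prod_eigenvalues
  rw [traceSnd_ketbra_trace, isUnitKet_iff.1 hφ, Fin.sum_univ_two] at ht
  rw [traceSnd_ketbra_det, Fin.prod_univ_two, Complex.normSq_eq_norm_sq] at hd
  rw [pureEoF, entropy, Fin.sum_univ_two]
  set a := hA.eigenvalues 0
  set b := hA.eigenvalues 1
  have ht' : 1 = a + b := by
    have : ((1 : ℝ) : ℂ) = (a : ℂ) + (b : ℂ) := ht
    exact_mod_cast this
  have hd' : ‖det2 φ‖ ^ 2 = a * b := by
    have : ((‖det2 φ‖ ^ 2 : ℝ) : ℂ) = (a : ℂ) * (b : ℂ) := hd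
    exact_mod_cast this
  have hb : b = 1 - a := by linarith
  have e1 : 1 - (2 * ‖det2 φ‖) ^ 2 = (2 * a - 1) ^ 2 := by
    rw [mul_pow, hd', hb]; ring
  have : -(a * Real.logb 2 a + b * Real.logb 2 b) = h a := by
    rw [hb, h]; ring
  rw [this, concEnt, e1, Real.sqrt_sq_eq_abs]
  rcases abs_choice (2 * a - 1) with h' | h'
  · rw [h']; congr 1; ring
  · rw [h', ← h_one_sub]; congr 1; ring

theorem pureEoF_nonneg {φ : Ket2} (hφ : IsUnitKet φ) : 0 ≤ pureEoF φ := by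
  rw [pureEoF_eq hφ]
  exact concEnt_nonneg _

theorem bddBelow_decompositions (σ : Matrix (Fin 2 × Fin 2) (Fin 2 × Fin 2) ℂ) :
    BddBelow {e : ℝ | ∃ (k : ℕ) (p : Fin k → ℝ) (φ : Fin k → Fin 2 × Fin 2 → ℂ),
      IsPureDecomposition σ p φ ∧ e = ∑ i, p i * pureEoF (φ i)} := by
  refine ⟨0, ?_⟩
  rintro _ ⟨k, p, φ, hd, rfl⟩
  exact Finset.sum_nonneg fun i _ => mul_nonneg (hd.1 i) (pureEoF_nonneg (hd.2.2.1 i))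

/-- A unit ket proportional to `v`. -/
def normalize (v : Ket2) : Ket2 :=
  -- A zero ket carries weight zero, so any unit ket may stand for it.
  if nsq v = 0 then Pi.single (0, 0) 1 else ((Real.sqrt (nsq v))⁻¹ : ℂ) • v

theorem isUnitKet_normalize (v : Ket2) : IsUnitKet (normalize v) := by
  rw [isUnitKet_iff, normalize]
  split_ifs with h0
  · rw [nsq_ket2]; simp
  · rw [nsq_smul, ← Complex.ofReal_inv, Complex.normSq_ofReal, ← mul_inv,
      Real.mul_self_sqrt (nsq_nonneg v), inv_mul_cancel₀ h0]

theorem nsq_smul_ketbra_normalize (v : Ket2) :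
    (nsq v : ℂ) • ketbra (normalize v) = ketbra v := by
  rw [normalize]
  split_ifs with h0
  · rw [nsq_eq_zero.1 h0]
    ext
    simp [nsq_ket2, ketbra, Matrix.vecMulVec_apply]
  · rw [ketbra_smul, smul_smul, ← Complex.ofReal_inv, Complex.normSq_ofReal, ← mul_inv,
      Real.mul_self_sqrt (nsq_nonneg v), ← Complex.ofReal_mul, mul_inv_cancel₀ h0]
    simp

theorem nsq_mul_pureEoF_normalize (v : Ket2) : nsq v * pureEoF (normalize v) = cost v := by
  rcases eq_or_ne (nsq v) 0 with h0 | h0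
  · simp [cost, h0]
  · rw [pureEoF_eq (isUnitKet_normalize v), cost, normalize, if_neg h0, det2_smul, norm_mul,
      norm_pow, norm_inv, inv_pow, Complex.norm_real, Real.norm_eq_abs, sq_abs,
      Real.sq_sqrt (nsq_nonneg v)]
    congr 2
    field_simp

theorem HasDecomp.exists_isPureDecomposition {σ : Matrix (Fin 2 × Fin 2) (Fin 2 × Fin 2) ℂ} {e : ℝ}
    (h : HasDecomp σ e) (ht : σ.trace = 1) :
    ∃ (k : ℕ) (p : Fin k → ℝ) (φ : Fin k → Fin 2 × Fin 2 → ℂ),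
      IsPureDecomposition σ p φ ∧ ∑ i, p i * pureEoF (φ i) ≤ e := by
  obtain ⟨l, rfl, hl⟩ := h
  refine ⟨l.length, fun i => nsq l[i], fun i => normalize l[i], ⟨fun i => nsq_nonneg _, ?_,
    fun i => isUnitKet_normalize _, ?_⟩, ?_⟩
  · have : ((l.map ketbra).sum).trace = ((l.map nsq).sum : ℝ) := by
      clear ht hl
      induction l with
      | nil => simp
      | cons v l ih => simp [ih, trace_ketbra]
    rw [ht] at this
    exact (Fin.sum_univ_fun_getElem l nsq).trans (by exact_mod_cast this.symm)
  · simp only [nsq_smul_ketbra_normalize]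
    exact (Fin.sum_univ_fun_getElem l ketbra).symm
  · simp only [nsq_mul_pureEoF_normalize]
    exact (Fin.sum_univ_fun_getElem l cost).trans_le hl

theorem HasDecomp.eoF_le {σ : Matrix (Fin 2 × Fin 2) (Fin 2 × Fin 2) ℂ} {e : ℝ}
    (h : HasDecomp σ e) (ht : σ.trace = 1) : EoF σ ≤ e := by
  obtain ⟨k, p, φ, hd, hle⟩ := h.exists_isPureDecomposition ht
  exact (csInf_le (bddBelow_decompositions σ) ⟨k, p, φ, hd, rfl⟩).trans hle

/-! ### Operators of rank two -/

/-- A traceless real quadratic form has an isotropic unit vector: its value changes sign under a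
quarter turn. -/
theorem exists_rotation (A B : ℝ) :
    ∃ x y : ℝ, x ^ 2 + y ^ 2 = 1 ∧ A * (x ^ 2 - y ^ 2) + B * (x * y) = 0 := by
  have hc : Continuous fun t : ℝ => A * (Real.cos t ^ 2 - Real.sin t ^ 2) +
    B * (Real.cos t * Real.sin t) := by fun_prop
  have h0 : A * (Real.cos 0 ^ 2 - Real.sin 0 ^ 2) + B * (Real.cos 0 * Real.sin 0) = A := by simp
  have h1 : A * (Real.cos (Real.pi / 2) ^ 2 - Real.sin (Real.pi / 2) ^ 2) +
    B * (Real.cos (Real.pi / 2) * Real.sin (Real.pi / 2)) = -A := by simp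
  have hm : (0 : ℝ) ∈ Set.uIcc (A * (Real.cos 0 ^ 2 - Real.sin 0 ^ 2) +
      B * (Real.cos 0 * Real.sin 0)) (A * (Real.cos (Real.pi / 2) ^ 2 -
      Real.sin (Real.pi / 2) ^ 2) + B * (Real.cos (Real.pi / 2) * Real.sin (Real.pi / 2))) := by
    rw [h0, h1, Set.mem_uIcc]
    rcases le_total A 0 with h | h
    · left; constructor <;> linarith
    · right; constructor <;> linarith
  obtain ⟨t, -, ht⟩ := intermediate_value_uIcc hc.continuousOn hm
  exact ⟨Real.cos t, Real.sin t, Real.cos_sq_add_sin_sq t, ht⟩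

theorem exists_phase (z : ℂ) : ∃ u : ℂ, Complex.normSq u = 1 ∧ u * z = (‖z‖ : ℂ) := by
  rcases eq_or_ne z 0 with rfl | hz
  · exact ⟨1, by simp, by simp⟩
  · have hn : (‖z‖ : ℂ) ≠ 0 := by simpa using hz
    refine ⟨starRingEnd ℂ z / ‖z‖, ?_, ?_⟩
    · rw [Complex.normSq_div, Complex.normSq_conj, Complex.normSq_ofReal,
        Complex.normSq_eq_norm_sq, ← sq, div_self]
      simpa using hz
    · rw [div_mul_eq_mul_div, Complex.conj_mul', div_eq_iff hn, sq]

theorem exists_phase_sq (z : ℂ) : ∃ u : ℂ, Complex.normSq u = 1 ∧ u ^ 2 * z = (‖z‖ : ℂ) := by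
  obtain ⟨u, hu, huz⟩ := exists_phase z
  obtain ⟨w, hw⟩ := IsAlgClosed.exists_pow_nat_eq u two_pos
  refine ⟨w, ?_, by rw [hw, huz]⟩
  have : Complex.normSq w ^ 2 = 1 := by rw [← map_pow, hw, hu]
  have h0 := Complex.normSq_nonneg w
  nlinarith

/-- The polarization of `det2`. -/
def polar2 (v w : Ket2) : ℂ := v (0, 0) * w (1, 1) + v (1, 1) * w (0, 0) -
  v (0, 1) * w (1, 0) - v (1, 0) * w (0, 1)

theorem det2_add_smul (x y : ℂ) (v w : Ket2) :
    det2 (x • v + y • w) = x ^ 2 * det2 v + x * y * polar2 v w + y ^ 2 * det2 w := by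
  simp [det2, polar2]
  ring

theorem ketbra_phase {n : Type*} [Fintype n] {u : ℂ} (hu : Complex.normSq u = 1) (v : n → ℂ) :
    ketbra (u • v) = ketbra v := by
  rw [ketbra_smul, hu]; simp

theorem hasDecomp_pair_aux {v w : Ket2} {δ β : ℝ} (hδ : 0 ≤ δ) (hv : det2 v = δ)
    (hvw : polar2 v w = β) (hw : det2 w = 0) (hN : 0 < nsq v + nsq w) :
    HasDecomp (ketbra v + ketbra w)
      ((nsq v + nsq w) * concEnt (2 * δ / (nsq v + nsq w))) := by
  set N := nsq v + nsq w with hNdef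
  set g : ℝ := ∑ i, ((v i).re * (w i).re + (v i).im * (w i).im) with hg
  have hnsq : ∀ x y : ℝ, nsq ((x : ℂ) • v + (y : ℂ) • w) =
      x ^ 2 * nsq v + y ^ 2 * nsq w + 2 * x * y * g := by
    intro x y
    rw [nsq, nsq, nsq, hg, Finset.mul_sum, Finset.mul_sum, Finset.mul_sum,
      ← Finset.sum_add_distrib, ← Finset.sum_add_distrib]
    refine Finset.sum_congr rfl fun i _ => ?_
    simp [Complex.normSq_apply]
    ring
  -- The form is `N * det2 - δ * nsq` evaluated at `x • v + y • w`. It is traceless because `det2`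
  -- sums to `δ` and `nsq` to `N` over the pair. Vanishing at `(x, y)`, it vanishes at `(-y, x)`
  -- too, so both rotated kets have concurrence `2δ/N`.
  obtain ⟨x, y, hxy, hrot⟩ := exists_rotation (δ * nsq w) (N * β - 2 * δ * g)
  have hmix := ketbra_add_ketbra_mix (rowUnitary x y (by
    rw [Complex.normSq_ofReal, Complex.normSq_ofReal]; nlinarith)) ![v, w]
  simp [rowUnitary] at hmix
  have d0 : N * ‖det2 ((x : ℂ) • v + (y : ℂ) • w)‖ =
      δ * nsq ((x : ℂ) • v + (y : ℂ) • w) := by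
    have hd : det2 ((x : ℂ) • v + (y : ℂ) • w) = ((x ^ 2 * δ + x * y * β : ℝ) : ℂ) := by
      rw [det2_add_smul, hv, hvw, hw]; push_cast; ring
    have e : N * (x ^ 2 * δ + x * y * β) = δ * nsq ((x : ℂ) • v + (y : ℂ) • w) := by
      rw [hnsq, hNdef]; rw [hNdef] at hrot; linear_combination hrot
    rw [hd, Complex.norm_real, Real.norm_eq_abs, ← e, abs_of_nonneg]
    have := mul_nonneg hδ (nsq_nonneg ((x : ℂ) • v + (y : ℂ) • w))
    rw [← e] at this
    exact nonneg_of_mul_nonneg_right this hN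
  have d1 : N * ‖det2 (((-y : ℝ) : ℂ) • v + (x : ℂ) • w)‖ =
      δ * nsq (((-y : ℝ) : ℂ) • v + (x : ℂ) • w) := by
    have hd : det2 (((-y : ℝ) : ℂ) • v + (x : ℂ) • w) = ((y ^ 2 * δ - x * y * β : ℝ) : ℂ) := by
      rw [det2_add_smul, hv, hvw, hw]; push_cast; ring
    have e : N * (y ^ 2 * δ - x * y * β) = δ * nsq (((-y : ℝ) : ℂ) • v + (x : ℂ) • w) := by
      rw [hnsq, hNdef]; rw [hNdef] at hrot
      linear_combination (-1) * hrot
    rw [hd, Complex.norm_real, Real.norm_eq_abs, ← e, abs_of_nonneg]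
    have := mul_nonneg hδ (nsq_nonneg (((-y : ℝ) : ℂ) • v + (x : ℂ) • w))
    rw [← e] at this
    exact nonneg_of_mul_nonneg_right this hN
  have h2 := (HasDecomp.single ((x : ℂ) • v + (y : ℂ) • w)).add
    (HasDecomp.single (((-y : ℝ) : ℂ) • v + (x : ℂ) • w))
  rw [cost_of_mul_eq hN d0, cost_of_mul_eq hN d1, ← add_mul, hnsq, hnsq] at h2
  simp only [Complex.ofReal_neg, Complex.coe_smul, neg_smul] at h2
  rw [hmix] at h2
  convert h2 using 2
  rw [hNdef]
  linear_combination (-(nsq v + nsq w)) * hxy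

/-- An operator of rank two whose second component is a product ket decomposes into kets of
equal concurrence. -/
theorem hasDecomp_pair {v w : Ket2} (hw : det2 w = 0) :
    HasDecomp (ketbra v + ketbra w)
      ((nsq v + nsq w) * concEnt (2 * ‖det2 v‖ / (nsq v + nsq w))) := by
  rcases (add_nonneg (nsq_nonneg v) (nsq_nonneg w)).eq_or_lt with h0 | h0
  · have h1 : v = 0 := nsq_eq_zero.1 (by linarith [nsq_nonneg v, nsq_nonneg w])
    have h2 : w = 0 := nsq_eq_zero.1 (by linarith [nsq_nonneg v, nsq_nonneg w])
    have : ketbra v + ketbra w = 0 := by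
      ext; simp [h1, h2, ketbra]
    rw [← h0, this, zero_mul]
    exact HasDecomp.zero
  -- Two free phases make `det2 v` and the polarization real and nonnegative; `det2 w = 0` is
  -- unaffected by its phase.
  · obtain ⟨u, hu, hud⟩ := exists_phase_sq (det2 v)
    obtain ⟨t, ht, htp⟩ := exists_phase (polar2 (u • v) w)
    have nv : nsq (u • v) = nsq v := by rw [nsq_smul, hu, one_mul]
    have nw : nsq (t • w) = nsq w := by rw [nsq_smul, ht, one_mul]
    have := hasDecomp_pair_aux (v := u • v) (w := t • w) (δ := ‖det2 v‖)
      (β := ‖polar2 (u • v) w‖) (norm_nonneg _) (by rw [det2_smul, hud])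
      (by rw [← htp]; simp [polar2]; ring) (by rw [det2_smul, hw, mul_zero]) (by rwa [nv, nw])
    rwa [nv, nw, ketbra_phase hu, ketbra_phase ht] at this

/-! ### Local unitaries on three qubits -/

/-- A ket of three qubits. -/
abbrev Ket3 : Type := Idx → ℂ

/-- The unitary group of a qubit. -/
abbrev U2 : Type := Matrix.unitaryGroup (Fin 2) ℂ

/-- The local unitary `U ⊗ V ⊗ W`. -/
def localU (U V W : U2) : Matrix Idx Idx ℂ :=
  (U : Matrix (Fin 2) (Fin 2) ℂ) ⊗ₖ
    ((V : Matrix (Fin 2) (Fin 2) ℂ) ⊗ₖ (W : Matrix (Fin 2) (Fin 2) ℂ))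

/-- The action of local unitaries on kets. -/
def act (U V W : U2) (ψ : Ket3) : Ket3 := localU U V W *ᵥ ψ

theorem localU_mul (U V W U' V' W' : U2) :
    localU U V W * localU U' V' W' = localU (U * U') (V * V') (W * W') := by
  simp only [localU, ← Matrix.mul_kronecker_mul]
  rfl

theorem localU_one : localU 1 1 1 = 1 := by
  simp [localU]

theorem conjTranspose_localU (U V W : U2) : (localU U V W)ᴴ = localU U⁻¹ V⁻¹ W⁻¹ := by
  simp only [localU, Matrix.conjTranspose_kronecker]
  rfl

theorem act_act (U V W U' V' W' : U2) (ψ : Ket3) :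
    act U V W (act U' V' W' ψ) = act (U * U') (V * V') (W * W') ψ := by
  rw [act, act, act, Matrix.mulVec_mulVec, localU_mul]

theorem act_inv_act (U V W : U2) (ψ : Ket3) : act U⁻¹ V⁻¹ W⁻¹ (act U V W ψ) = ψ := by
  rw [act_act]
  simp [act, localU_one]

theorem act_add (U V W : U2) (ψ χ : Ket3) : act U V W (ψ + χ) = act U V W ψ + act U V W χ :=
  Matrix.mulVec_add _ _ _

theorem act_smul (U V W : U2) (c : ℂ) (ψ : Ket3) : act U V W (c • ψ) = c • act U V W ψ :=
  Matrix.mulVec_smul _ _ _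

theorem act_zero (U V W : U2) : act U V W 0 = 0 := Matrix.mulVec_zero _

theorem act_apply (U V W : U2) (ψ : Ket3) (a b c : Fin 2) :
    act U V W ψ (a, b, c) =
      U a 0 * V b 0 * W c 0 * ψ (0, 0, 0) + U a 0 * V b 0 * W c 1 * ψ (0, 0, 1) +
      U a 0 * V b 1 * W c 0 * ψ (0, 1, 0) + U a 0 * V b 1 * W c 1 * ψ (0, 1, 1) +
      U a 1 * V b 0 * W c 0 * ψ (1, 0, 0) + U a 1 * V b 0 * W c 1 * ψ (1, 0, 1) +
      U a 1 * V b 1 * W c 0 * ψ (1, 1, 0) + U a 1 * V b 1 * W c 1 * ψ (1, 1, 1) := by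
  simp [act, localU, Matrix.mulVec, dotProduct, Fintype.sum_prod_type, Fin.sum_univ_two,
    Matrix.kroneckerMap_apply]
  ring

theorem nsq_act (U V W : U2) (ψ : Ket3) : nsq (act U V W ψ) = nsq ψ := by
  apply nsq_mulVec
  rw [conjTranspose_localU, localU_mul]
  simp [localU_one]

theorem star_dotProduct_act (U V W : U2) (ψ χ : Ket3) :
    star (act U V W ψ) ⬝ᵥ act U V W χ = star ψ ⬝ᵥ χ := by
  rw [act, act, Matrix.star_mulVec, Matrix.dotProduct_mulVec, Matrix.vecMul_vecMul,
    conjTranspose_localU, localU_mul]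
  simp [localU_one]

theorem nsq_ket3 (ψ : Ket3) : nsq ψ = Complex.normSq (ψ (0, 0, 0)) + Complex.normSq (ψ (0, 0, 1)) +
    Complex.normSq (ψ (0, 1, 0)) + Complex.normSq (ψ (0, 1, 1)) +
    Complex.normSq (ψ (1, 0, 0)) + Complex.normSq (ψ (1, 0, 1)) +
    Complex.normSq (ψ (1, 1, 0)) + Complex.normSq (ψ (1, 1, 1)) := by
  simp [nsq, Fintype.sum_prod_type, Fin.sum_univ_two]
  ring

/-! ### Reduced states -/

/-- The component of a ket in which the qubit `C` has the label `c`. -/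
def slice (ψ : Ket3) (c : Fin 2) : Ket2 := fun x => ψ (x.1, x.2, c)

/-- Exchange of the qubits `B` and `C`. -/
def permAC (ψ : Ket3) : Ket3 := fun x => ψ (x.1, x.2.2, x.2.1)

/-- Cyclic permutation bringing `B`, `C` to the first two places. -/
def permBC (ψ : Ket3) : Ket3 := fun x => ψ (x.2.2, x.1, x.2.1)

theorem redAB_ketbra (ψ : Ket3) :
    redAB (ketbra ψ) = ketbra (slice ψ 0) + ketbra (slice ψ 1) := by
  ext x y
  simp [redAB, ketbra, Matrix.vecMulVec_apply, slice]

theorem redAC_ketbra (ψ : Ket3) : redAC (ketbra ψ) = redAB (ketbra (permAC ψ)) := rfl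

theorem redBC_ketbra (ψ : Ket3) : redBC (ketbra ψ) = redAB (ketbra (permBC ψ)) := rfl

theorem permAC_act (U V W : U2) (ψ : Ket3) : permAC (act U V W ψ) = act U W V (permAC ψ) := by
  ext ⟨a, b, c⟩
  change act U V W ψ (a, c, b) = _
  simp only [act_apply, permAC]
  ring

theorem permBC_act (U V W : U2) (ψ : Ket3) : permBC (act U V W ψ) = act V W U (permBC ψ) := by
  ext ⟨a, b, c⟩
  change act U V W ψ (c, a, b) = _
  simp only [act_apply, permBC]
  ring

theorem nsq_permAC (ψ : Ket3) : nsq (permAC ψ) = nsq ψ := by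
  simp only [nsq_ket3, permAC]; ring

theorem nsq_permBC (ψ : Ket3) : nsq (permBC ψ) = nsq ψ := by
  simp only [nsq_ket3, permBC]; ring

theorem redAB_add (ρ σ : Matrix Idx Idx ℂ) : redAB (ρ + σ) = redAB ρ + redAB σ := by
  ext; simp [redAB, Finset.sum_add_distrib]

theorem redAC_add (ρ σ : Matrix Idx Idx ℂ) : redAC (ρ + σ) = redAC ρ + redAC σ := by
  ext; simp [redAC, Finset.sum_add_distrib]

theorem redBC_add (ρ σ : Matrix Idx Idx ℂ) : redBC (ρ + σ) = redBC ρ + redBC σ := by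
  ext; simp [redBC, Finset.sum_add_distrib]

theorem trace_redAB (ρ : Matrix Idx Idx ℂ) : (redAB ρ).trace = ρ.trace := by
  simp [redAB, Matrix.trace, Fintype.sum_prod_type, Fin.sum_univ_two]

theorem trace_redAC (ρ : Matrix Idx Idx ℂ) : (redAC ρ).trace = ρ.trace := by
  simp [redAC, Matrix.trace, Fintype.sum_prod_type, Fin.sum_univ_two]; ring

theorem trace_redBC (ρ : Matrix Idx Idx ℂ) : (redBC ρ).trace = ρ.trace := by
  simp [redBC, Matrix.trace, Fintype.sum_prod_type, Fin.sum_univ_two]; ring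

theorem slice_act (U V W : U2) (ψ : Ket3) (c : Fin 2) :
    slice (act U V W ψ) c =
      W c 0 • (((U : Matrix (Fin 2) (Fin 2) ℂ) ⊗ₖ (V : Matrix (Fin 2) (Fin 2) ℂ)) *ᵥ slice ψ 0) +
      W c 1 • (((U : Matrix (Fin 2) (Fin 2) ℂ) ⊗ₖ (V : Matrix (Fin 2) (Fin 2) ℂ)) *ᵥ slice ψ 1) := by
  ext ⟨a, b⟩
  change act U V W ψ (a, b, c) = _
  simp only [act_apply, Pi.add_apply, Pi.smul_apply, kronecker_mulVec_apply, slice, smul_eq_mul]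
  ring

theorem redAB_act (U V W : U2) (ψ : Ket3) :
    redAB (ketbra (act U V W ψ)) =
      ((U : Matrix (Fin 2) (Fin 2) ℂ) ⊗ₖ (V : Matrix (Fin 2) (Fin 2) ℂ)) * redAB (ketbra ψ) *
      ((U : Matrix (Fin 2) (Fin 2) ℂ) ⊗ₖ (V : Matrix (Fin 2) (Fin 2) ℂ))ᴴ := by
  rw [redAB_ketbra, redAB_ketbra, slice_act, slice_act]
  have := ketbra_add_ketbra_mix W fun c =>
    ((U : Matrix (Fin 2) (Fin 2) ℂ) ⊗ₖ (V : Matrix (Fin 2) (Fin 2) ℂ)) *ᵥ slice ψ c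
  rw [this, ketbra_mulVec, ketbra_mulVec, mul_add, add_mul]

theorem HasDecomp.redAB_act {ψ χ : Ket3} {e : ℝ} (U V W : U2)
    (h : HasDecomp (redAB (ketbra ψ + ketbra χ)) e) :
    HasDecomp (redAB (ketbra (act U V W ψ) + ketbra (act U V W χ))) e := by
  have := h.conj U V
  rwa [redAB_add, mul_add, add_mul, ← ThreeQubit.redAB_act, ← ThreeQubit.redAB_act,
    ← redAB_add] at this

/-- All three reduced states decompose, with total cost at most `e`. -/
def HasDecomp3 (ρ : Matrix Idx Idx ℂ) (e : ℝ) : Prop :=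
  ∃ e₁ e₂ e₃, HasDecomp (redAB ρ) e₁ ∧ HasDecomp (redAC ρ) e₂ ∧ HasDecomp (redBC ρ) e₃ ∧
    e₁ + e₂ + e₃ ≤ e

namespace HasDecomp3

variable {ρ σ : Matrix Idx Idx ℂ} {e f : ℝ}

theorem add (hρ : HasDecomp3 ρ e) (hσ : HasDecomp3 σ f) : HasDecomp3 (ρ + σ) (e + f) := by
  obtain ⟨e₁, e₂, e₃, h₁, h₂, h₃, h⟩ := hρ
  obtain ⟨f₁, f₂, f₃, k₁, k₂, k₃, k⟩ := hσ
  refine ⟨e₁ + f₁, e₂ + f₂, e₃ + f₃, ?_, ?_, ?_, by linarith⟩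
  · rw [redAB_add]; exact h₁.add k₁
  · rw [redAC_add]; exact h₂.add k₂
  · rw [redBC_add]; exact h₃.add k₃

theorem zero : HasDecomp3 0 0 := by
  refine ⟨0, 0, 0, ?_, ?_, ?_, by simp⟩
  · convert HasDecomp.zero; ext; simp [redAB]
  · convert HasDecomp.zero; ext; simp [redAC]
  · convert HasDecomp.zero; ext; simp [redBC]

theorem sum {ι : Type*} (s : Finset ι) (ρ : ι → Matrix Idx Idx ℂ) (e : ι → ℝ)
    (h : ∀ i ∈ s, HasDecomp3 (ρ i) (e i)) : HasDecomp3 (∑ i ∈ s, ρ i) (∑ i ∈ s, e i) := by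
  classical
  induction s using Finset.induction_on with
  | empty => simpa using zero
  | insert i s hi ih =>
    rw [Finset.sum_insert hi, Finset.sum_insert hi]
    exact (h i (Finset.mem_insert_self i s)).add
      (ih fun j hj => h j (Finset.mem_insert_of_mem hj))

theorem sumEoF_le (hρ : HasDecomp3 ρ e) (ht : ρ.trace = 1) : sumEoF ρ ≤ e := by
  obtain ⟨e₁, e₂, e₃, h₁, h₂, h₃, h⟩ := hρ
  have := h₁.eoF_le (by rw [trace_redAB, ht])
  have := h₂.eoF_le (by rw [trace_redAC, ht])
  have := h₃.eoF_le (by rw [trace_redBC, ht])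
  rw [sumEoF]
  linarith

theorem act_add {ψ χ : Ket3} (U V W : U2) (h : HasDecomp3 (ketbra ψ + ketbra χ) e) :
    HasDecomp3 (ketbra (act U V W ψ) + ketbra (act U V W χ)) e := by
  obtain ⟨e₁, e₂, e₃, h₁, h₂, h₃, h⟩ := h
  refine ⟨e₁, e₂, e₃, h₁.redAB_act U V W, ?_, ?_, h⟩
  · rw [redAC_add, redAC_ketbra, redAC_ketbra, ← redAB_add] at h₂ ⊢
    rw [permAC_act, permAC_act]
    exact h₂.redAB_act _ _ _
  · rw [redBC_add, redBC_ketbra, redBC_ketbra, ← redAB_add] at h₃ ⊢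
    rw [permBC_act, permBC_act]
    exact h₃.redAB_act _ _ _

theorem act {ψ : Ket3} (U V W : U2) (h : HasDecomp3 (ketbra ψ) e) :
    HasDecomp3 (ketbra (act U V W ψ)) e := by
  have h0 : ketbra (0 : Ket3) = 0 := by ext; simp [ketbra]
  have := act_add (ψ := ψ) (χ := 0) (e := e) U V W (by rwa [h0, add_zero])
  rwa [act_zero, h0, add_zero] at this

end HasDecomp3

/-! ### Kets equivalent to the W state -/

/-- Multiples of kets that are locally equivalent to the W state. -/
def WLike (ψ : Ket3) : Prop := ∃ (c : ℂ) (U V W : U2), ψ = c • act U V W ketW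

theorem ketW_apply (a b c : Fin 2) :
    ketW (a, b, c) = ((1 / Real.sqrt 3 : ℝ) : ℂ) *
      ((if (a, b, c) = ((0, 0, 1) : Idx) then 1 else 0) +
        (if (a, b, c) = ((0, 1, 0) : Idx) then 1 else 0) +
        (if (a, b, c) = ((1, 0, 0) : Idx) then 1 else 0)) := by
  simp [ketW, Pi.single_apply]

theorem permAC_ketW : permAC ketW = ketW := by
  ext ⟨a, b, c⟩
  change ketW (a, c, b) = _
  rw [ketW_apply, ketW_apply]
  fin_cases a <;> fin_cases b <;> fin_cases c <;> simp

theorem permBC_ketW : permBC ketW = ketW := by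
  ext ⟨a, b, c⟩
  change ketW (c, a, b) = _
  rw [ketW_apply, ketW_apply]
  fin_cases a <;> fin_cases b <;> fin_cases c <;> simp

theorem nsq_ketW : nsq ketW = 1 := by
  simp only [nsq_ket3, ketW_apply, map_mul, Complex.normSq_ofReal]
  have : (1 / Real.sqrt 3) * (1 / Real.sqrt 3) = 1 / 3 := by
    rw [div_mul_div_comm, Real.mul_self_sqrt (by norm_num), one_mul]
  rw [this]
  norm_num

namespace WLike

variable {ψ : Ket3}

theorem zero : WLike 0 := ⟨0, 1, 1, 1, by simp⟩

theorem act (U V W : U2) (h : WLike ψ) : WLike (act U V W ψ) := by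
  obtain ⟨c, U', V', W', rfl⟩ := h
  exact ⟨c, U * U', V * V', W * W', by rw [act_smul, act_act]⟩

theorem of_act {U V W : U2} (h : WLike (ThreeQubit.act U V W ψ)) : WLike ψ := by
  have := h.act U⁻¹ V⁻¹ W⁻¹
  rwa [act_inv_act] at this

theorem smul (c : ℂ) (h : WLike ψ) : WLike (c • ψ) := by
  obtain ⟨c', U', V', W', rfl⟩ := h
  exact ⟨c * c', U', V', W', by rw [smul_smul]⟩

theorem permAC (h : WLike ψ) : WLike (permAC ψ) := by
  obtain ⟨c, U, V, W, rfl⟩ := h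
  refine ⟨c, U, W, V, ?_⟩
  conv_rhs => rw [← permAC_ketW, ← permAC_act]
  rfl

theorem permBC (h : WLike ψ) : WLike (permBC ψ) := by
  obtain ⟨c, U, V, W, rfl⟩ := h
  refine ⟨c, V, W, U, ?_⟩
  conv_rhs => rw [← permBC_ketW, ← permBC_act]
  rfl

end WLike

/-! ### A canonical form of three-qubit kets -/

theorem exists_unit_root (A B C : ℂ) : ∃ x y : ℂ, Complex.normSq x + Complex.normSq y = 1 ∧
    x ^ 2 * A + x * y * B + y ^ 2 * C = 0 := by
  by_cases hA : A = 0
  · exact ⟨1, 0, by simp, by simp [hA]⟩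
  · obtain ⟨s, hs⟩ := IsAlgClosed.exists_pow_nat_eq (B ^ 2 - 4 * A * C) two_pos
    set z := (-B + s) / (2 * A) with hz
    have hz0 : z ^ 2 * A + z * B + C = 0 := by
      rw [hz]; field_simp; linear_combination hs
    have hn : 0 < Complex.normSq z + 1 := by linarith [Complex.normSq_nonneg z]
    have hr : Complex.normSq ((Real.sqrt (Complex.normSq z + 1) : ℂ)⁻¹) =
        (Complex.normSq z + 1)⁻¹ := by
      rw [map_inv₀, Complex.normSq_ofReal, Real.mul_self_sqrt hn.le]
    set r : ℂ := (Real.sqrt (Complex.normSq z + 1) : ℂ)⁻¹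
    refine ⟨z * r, r, ?_, ?_⟩
    · rw [map_mul, hr]; field_simp
    · linear_combination r ^ 2 * hz0

theorem exists_unitary_annihilating {x y x' y' : ℂ} (h : x * y' = y * x') :
    ∃ U : U2, U 1 0 * x + U 1 1 * y = 0 ∧ U 1 0 * x' + U 1 1 * y' = 0 := by
  have key : ∀ x y : ℂ, ∃ U : U2, U 1 0 * x + U 1 1 * y = 0 := by
    intro x y
    by_cases hxy : Complex.normSq x + Complex.normSq y = 0
    · refine ⟨1, ?_⟩
      have hx : x = 0 := Complex.normSq_eq_zero.1
        (by linarith [Complex.normSq_nonneg x, Complex.normSq_nonneg y])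
      have hy : y = 0 := Complex.normSq_eq_zero.1
        (by linarith [Complex.normSq_nonneg x, Complex.normSq_nonneg y])
      simp [hx, hy]
    · have hn : 0 ≤ Complex.normSq x + Complex.normSq y :=
        add_nonneg (Complex.normSq_nonneg x) (Complex.normSq_nonneg y)
      have hr : Complex.normSq ((Real.sqrt (Complex.normSq x + Complex.normSq y) : ℂ)⁻¹) =
          (Complex.normSq x + Complex.normSq y)⁻¹ := by
        rw [map_inv₀, Complex.normSq_ofReal, Real.mul_self_sqrt hn]
      set r : ℂ := (Real.sqrt (Complex.normSq x + Complex.normSq y) : ℂ)⁻¹ with hrdef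
      have hrc : starRingEnd ℂ r = r := by rw [hrdef, map_inv₀, Complex.conj_ofReal]
      -- The second row of this unitary is `(-y * r, x * r)`.
      refine ⟨rowUnitary (starRingEnd ℂ x * r) (starRingEnd ℂ y * r) ?_, ?_⟩
      · rw [map_mul, map_mul, hr, Complex.normSq_conj, Complex.normSq_conj, ← add_mul,
          mul_inv_cancel₀ hxy]
      · simp [rowUnitary, hrc]
        ring
  by_cases hx : x = 0
  · by_cases hy : y = 0
    · obtain ⟨U, hU⟩ := key x' y'
      exact ⟨U, by simp [hx, hy], hU⟩
    · obtain ⟨U, hU⟩ := key x y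
      refine ⟨U, hU, mul_left_cancel₀ hy ?_⟩
      linear_combination y' * hU - U 1 0 * h
  · obtain ⟨U, hU⟩ := key x y
    refine ⟨U, hU, mul_left_cancel₀ hx ?_⟩
    linear_combination x' * hU + U 1 1 * h

/-- Local unitaries bring every ket to a form with three vanishing coefficients. -/
theorem exists_canonical (ψ : Ket3) : ∃ U V W : U2, act U V W ψ (0, 0, 1) = 0 ∧
    act U V W ψ (0, 1, 0) = 0 ∧ act U V W ψ (0, 1, 1) = 0 := by
  -- The coefficients are those of the determinant of the `2 × 2` matrix (indexed by B, C) obtained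
  -- by combining the blocks A = 0 and A = 1 with weights `x`, `y`; a root makes the new A = 0 block
  -- singular.
  obtain ⟨x, y, hxy, hroot⟩ := exists_unit_root
    (ψ (0, 0, 0) * ψ (0, 1, 1) - ψ (0, 0, 1) * ψ (0, 1, 0))
    (ψ (0, 0, 0) * ψ (1, 1, 1) + ψ (1, 0, 0) * ψ (0, 1, 1) - ψ (0, 0, 1) * ψ (1, 1, 0) -
      ψ (1, 0, 1) * ψ (0, 1, 0))
    (ψ (1, 0, 0) * ψ (1, 1, 1) - ψ (1, 0, 1) * ψ (1, 1, 0))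
  set U := rowUnitary x y hxy
  set χ := act U 1 1 ψ with hχ
  have hdet : χ (0, 0, 0) * χ (0, 1, 1) = χ (0, 0, 1) * χ (0, 1, 0) := by
    simp only [hχ, act_apply]
    simp [U, rowUnitary]
    linear_combination hroot
  -- The rows of the singular block are proportional, so one unitary on C clears its second column.
  -- A unitary on B then clears 010 and keeps that column zero.
  obtain ⟨W, hW0, hW1⟩ := exists_unitary_annihilating hdet
  set ξ := act 1 1 W χ with hξ
  have h001 : ξ (0, 0, 1) = 0 := by
    simp only [hξ, act_apply]
    simp
    linear_combination hW0
  have h011 : ξ (0, 1, 1) = 0 := by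
    simp only [hξ, act_apply]
    simp
    linear_combination hW1
  obtain ⟨V, hV, -⟩ := exists_unitary_annihilating (x := ξ (0, 0, 0)) (y := ξ (0, 1, 0))
    (x' := 0) (y' := 0) (by simp)
  refine ⟨1 * (1 * U), V * (1 * 1), 1 * (W * 1), ?_, ?_, ?_⟩ <;>
    rw [← act_act, ← act_act, ← hχ, ← hξ, act_apply] <;> simp [h001, h011]
  linear_combination hV

/-- With `S = a² + b² + c² + d²`, one has `m ≤ S/2`, and the gap is at least `(2l² - S)²/12 + l²(a²
+ d²)`. The vanishing of all slack terms is the equality case below. -/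
theorem sq_add_sq_add_sq_le {l a b c d m : ℝ} (hm0 : 0 ≤ m) (hm : m ≤ a * d + b * c) :
    (l * c) ^ 2 + (l * b) ^ 2 + m ^ 2 ≤ (l ^ 2 + a ^ 2 + b ^ 2 + c ^ 2 + d ^ 2) ^ 2 / 3 := by
  have h1 : m ≤ (a ^ 2 + b ^ 2 + c ^ 2 + d ^ 2) / 2 := by
    nlinarith [sq_nonneg (a - d), sq_nonneg (b - c)]
  have h2 : m ^ 2 ≤ ((a ^ 2 + b ^ 2 + c ^ 2 + d ^ 2) / 2) ^ 2 := pow_le_pow_left₀ hm0 h1 2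
  have h3 := sq_nonneg (2 * l ^ 2 - (a ^ 2 + b ^ 2 + c ^ 2 + d ^ 2))
  have h4 : 0 ≤ l ^ 2 * (a ^ 2 + d ^ 2) := by positivity
  nlinarith

theorem eq_of_sq_add_sq_add_sq_eq {l a b c d m : ℝ} (hl : 0 ≤ l) (hb : 0 ≤ b)
    (hm0 : 0 ≤ m) (hm : m ≤ a * d + b * c)
    (h : (l ^ 2 + a ^ 2 + b ^ 2 + c ^ 2 + d ^ 2) ^ 2 / 3 ≤ (l * c) ^ 2 + (l * b) ^ 2 + m ^ 2) :
    a = 0 ∧ d = 0 ∧ b = l ∧ c = l := by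
  have h1 : m ≤ (a ^ 2 + b ^ 2 + c ^ 2 + d ^ 2) / 2 := by
    nlinarith [sq_nonneg (a - d), sq_nonneg (b - c)]
  have h2 : m ^ 2 ≤ ((a ^ 2 + b ^ 2 + c ^ 2 + d ^ 2) / 2) ^ 2 := pow_le_pow_left₀ hm0 h1 2
  have h3 := sq_nonneg (2 * l ^ 2 - (a ^ 2 + b ^ 2 + c ^ 2 + d ^ 2))
  have h4 : 0 ≤ l ^ 2 * (a ^ 2 + d ^ 2) := by positivity
  have e1 : (2 * l ^ 2 - (a ^ 2 + b ^ 2 + c ^ 2 + d ^ 2)) ^ 2 = 0 := by nlinarith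
  have e2 : l ^ 2 * (a ^ 2 + d ^ 2) = 0 := by nlinarith
  have e3 : 2 * l ^ 2 = a ^ 2 + b ^ 2 + c ^ 2 + d ^ 2 := by
    have := pow_eq_zero_iff (two_ne_zero) |>.1 e1
    linarith
  have e4 : ((a ^ 2 + b ^ 2 + c ^ 2 + d ^ 2) / 2) ^ 2 ≤ m ^ 2 := by nlinarith
  have e5 : (a ^ 2 + b ^ 2 + c ^ 2 + d ^ 2) / 2 ≤ m := (sq_le_sq₀ (by positivity) hm0).1 e4
  have e6 : b = c := by
    have : (b - c) ^ 2 = 0 := by linarith [sq_nonneg (a - d), sq_nonneg (b - c)]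
    linarith [(pow_eq_zero_iff two_ne_zero).1 this]
  have e7 : a ^ 2 + d ^ 2 = 0 := by
    rcases mul_eq_zero.1 e2 with h0 | h0
    · linarith [sq_nonneg a, sq_nonneg b, sq_nonneg c, sq_nonneg d]
    · exact h0
  have ha : a = 0 := (pow_eq_zero_iff two_ne_zero).1 (by linarith [sq_nonneg a, sq_nonneg d])
  have hd : d = 0 := (pow_eq_zero_iff two_ne_zero).1 (by linarith [sq_nonneg a, sq_nonneg d])
  have hbl : b = l := by
    rw [← e6] at e3
    exact (pow_left_inj₀ hb hl two_ne_zero).1 (by linarith)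
  exact ⟨ha, hd, hbl, by rw [← e6, hbl]⟩

/-! ### The bound for pure states -/

/-- The unitary `diag(1, u)`. -/
def phaseUnitary (u : ℂ) (hu : Complex.normSq u = 1) : U2 :=
  ⟨!![1, 0; 0, u], by
    have : u * starRingEnd ℂ u = 1 := by rw [Complex.mul_conj, hu]; simp
    rw [Matrix.mem_unitaryGroup_iff]
    ext i j
    fin_cases i <;> fin_cases j <;> simp [Matrix.mul_apply, Matrix.star_apply, this]⟩

/-- The unitary exchanging the basis kets, with a phase. -/
def flipUnitary (u : ℂ) (hu : Complex.normSq u = 1) : U2 :=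
  ⟨!![0, u; 1, 0], by
    have : u * starRingEnd ℂ u = 1 := by rw [Complex.mul_conj, hu]; simp
    rw [Matrix.mem_unitaryGroup_iff]
    ext i j
    fin_cases i <;> fin_cases j <;> simp [Matrix.mul_apply, Matrix.star_apply, this]⟩

theorem exists_eq_norm_mul_phase (z : ℂ) :
    ∃ u : ℂ, Complex.normSq u = 1 ∧ z = (‖z‖ : ℂ) * u := by
  obtain ⟨u, hu, h⟩ := exists_phase z
  refine ⟨starRingEnd ℂ u, by rw [Complex.normSq_conj, hu], ?_⟩
  have : u * starRingEnd ℂ u = 1 := by rw [Complex.mul_conj, hu]; simp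
  linear_combination starRingEnd ℂ u * h - z * this

theorem wLike_of_canonical {χ : Ket3} (h1 : χ (0, 0, 1) = 0) (h2 : χ (0, 1, 0) = 0)
    (h3 : χ (0, 1, 1) = 0) (ha : χ (1, 0, 0) = 0) (hd : χ (1, 1, 1) = 0)
    (hb : ‖χ (1, 0, 1)‖ = ‖χ (0, 0, 0)‖) (hc : ‖χ (1, 1, 0)‖ = ‖χ (0, 0, 0)‖) : WLike χ := by
  obtain ⟨u, hu, eu⟩ := exists_eq_norm_mul_phase (χ (0, 0, 0))
  obtain ⟨t, ht, et⟩ := exists_eq_norm_mul_phase (χ (1, 0, 1))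
  obtain ⟨v, hv, ev⟩ := exists_eq_norm_mul_phase (χ (1, 1, 0))
  have hs : (Real.sqrt 3 : ℂ) ≠ 0 := by
    exact_mod_cast (Real.sqrt_pos.2 (by norm_num : (0 : ℝ) < 3)).ne'
  rw [hb] at et
  rw [hc] at ev
  -- Flipping A sends 100, 001, 010 to 000, 101, 110; the three phases go one to each qubit.
  refine ⟨‖χ (0, 0, 0)‖ * Real.sqrt 3, flipUnitary u hu, phaseUnitary v hv, phaseUnitary t ht, ?_⟩
  ext ⟨a, b, c⟩
  rw [Pi.smul_apply, act_apply]
  simp only [ketW_apply]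
  fin_cases a <;> fin_cases b <;> fin_cases c <;>
    simp [flipUnitary, phaseUnitary, h1, h2, h3, ha, hd]
  · linear_combination eu - (‖χ (0, 0, 0)‖ : ℂ) * u * mul_inv_cancel₀ hs
  · linear_combination et - (‖χ (0, 0, 0)‖ : ℂ) * t * mul_inv_cancel₀ hs
  · linear_combination ev - (‖χ (0, 0, 0)‖ : ℂ) * v * mul_inv_cancel₀ hs

/-- The C = 1 slice is supported on A = 1, hence is a product ket, and `hasDecomp_pair` applies. -/
theorem hasDecomp_canonicalAB {χ : Ket3} (h1 : χ (0, 0, 1) = 0) (h2 : χ (0, 1, 0) = 0)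
    (h3 : χ (0, 1, 1) = 0) : HasDecomp (redAB (ketbra χ))
      (nsq χ * concEnt (2 * (‖χ (0, 0, 0)‖ * ‖χ (1, 1, 0)‖) / nsq χ)) := by
  have hw : det2 (slice χ 1) = 0 := by simp [det2, slice, h1, h3]
  have hN : nsq (slice χ 0) + nsq (slice χ 1) = nsq χ := by
    rw [nsq_ket2, nsq_ket2, nsq_ket3]; simp only [slice]; ring
  have hv : ‖det2 (slice χ 0)‖ = ‖χ (0, 0, 0)‖ * ‖χ (1, 1, 0)‖ := by
    simp [det2, slice, h2]
  have := hasDecomp_pair (v := slice χ 0) hw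
  rwa [hN, hv, ← redAB_ketbra] at this

theorem hasDecomp_canonicalBC {χ : Ket3} (h1 : χ (0, 0, 1) = 0)
    (h3 : χ (0, 1, 1) = 0) : HasDecomp (redBC (ketbra χ))
      (nsq χ * concEnt (2 * ‖χ (1, 0, 0) * χ (1, 1, 1) - χ (1, 0, 1) * χ (1, 1, 0)‖ / nsq χ)) := by
  have hw : det2 (slice (permBC χ) 0) = 0 := by simp [det2, slice, permBC, h1, h3]
  have hN : nsq (slice (permBC χ) 1) + nsq (slice (permBC χ) 0) = nsq χ := by
    rw [nsq_ket2, nsq_ket2, nsq_ket3]; simp only [slice, permBC]; ring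
  have hv : det2 (slice (permBC χ) 1) =
      χ (1, 0, 0) * χ (1, 1, 1) - χ (1, 0, 1) * χ (1, 1, 0) := by
    simp [det2, slice, permBC]
  have := hasDecomp_pair (v := slice (permBC χ) 1) hw
  rwa [hN, hv, add_comm, ← redAB_ketbra, ← redBC_ketbra] at this

/-- The three tangent bounds add up, since the squared concurrences sum to at most `4/3 = 3 *
(4/9)`. Positivity of the slope turns equality of costs into equality in the quadratic inequality.
-/
theorem hasDecomp3_canonical {χ : Ket3} (h1 : χ (0, 0, 1) = 0) (h2 : χ (0, 1, 0) = 0)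
    (h3 : χ (0, 1, 1) = 0) :
    ∃ e, HasDecomp3 (ketbra χ) e ∧ e ≤ nsq χ * cMax ∧ (e = nsq χ * cMax → WLike χ) := by
  have hAB := hasDecomp_canonicalAB h1 h2 h3
  have hAC : HasDecomp (redAC (ketbra χ))
      (nsq χ * concEnt (2 * (‖χ (0, 0, 0)‖ * ‖χ (1, 0, 1)‖) / nsq χ)) := by
    have := hasDecomp_canonicalAB (χ := permAC χ) h2 h1 h3
    rwa [nsq_permAC, ← redAC_ketbra] at this
  have hBC := hasDecomp_canonicalBC h1 h3
  refine ⟨_, ⟨_, _, _, hAB, hAC, hBC, le_rfl⟩, ?_⟩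
  rcases (nsq_nonneg χ).eq_or_lt with h0 | hpos
  · rw [nsq_eq_zero.1 h0.symm]
    simp [nsq, WLike.zero]
  have hm : ‖χ (1, 0, 0) * χ (1, 1, 1) - χ (1, 0, 1) * χ (1, 1, 0)‖ ≤
      ‖χ (1, 0, 0)‖ * ‖χ (1, 1, 1)‖ + ‖χ (1, 0, 1)‖ * ‖χ (1, 1, 0)‖ := by
    simpa only [norm_mul] using norm_sub_le (χ (1, 0, 0) * χ (1, 1, 1)) (χ (1, 0, 1) * χ (1, 1, 0))
  have hN : nsq χ = ‖χ (0, 0, 0)‖ ^ 2 + ‖χ (1, 0, 0)‖ ^ 2 + ‖χ (1, 0, 1)‖ ^ 2 +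
      ‖χ (1, 1, 0)‖ ^ 2 + ‖χ (1, 1, 1)‖ ^ 2 := by
    rw [nsq_ket3, h1, h2, h3]; simp [Complex.normSq_eq_norm_sq]
  have hm0 := norm_nonneg (χ (1, 0, 0) * χ (1, 1, 1) - χ (1, 0, 1) * χ (1, 1, 0))
  have hle := sq_add_sq_add_sq_le (l := ‖χ (0, 0, 0)‖) hm0 hm
  have heq := eq_of_sq_add_sq_add_sq_eq (norm_nonneg (χ (0, 0, 0))) (norm_nonneg (χ (1, 0, 1)))
    hm0 hm
  rw [← hN] at hle heq
  generalize hmd : ‖χ (1, 0, 0) * χ (1, 1, 1) - χ (1, 0, 1) * χ (1, 1, 0)‖ = m at *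
  have hl := norm_nonneg (χ (0, 0, 0))
  have hb := norm_nonneg (χ (1, 0, 1))
  have hc := norm_nonneg (χ (1, 1, 0))
  have hW : ‖χ (1, 0, 0)‖ = 0 ∧ ‖χ (1, 1, 1)‖ = 0 ∧ ‖χ (1, 0, 1)‖ = ‖χ (0, 0, 0)‖ ∧
      ‖χ (1, 1, 0)‖ = ‖χ (0, 0, 0)‖ → WLike χ := fun h =>
    wLike_of_canonical h1 h2 h3 (norm_eq_zero.1 h.1) (norm_eq_zero.1 h.2.1) h.2.2.1 h.2.2.2
  generalize ‖χ (0, 0, 0)‖ = l at *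
  generalize ‖χ (1, 0, 0)‖ = a at *
  generalize ‖χ (1, 0, 1)‖ = b at *
  generalize ‖χ (1, 1, 0)‖ = c at *
  generalize ‖χ (1, 1, 1)‖ = d at *
  generalize nsq χ = N at *
  clear hAB hAC hBC hmd
  obtain ⟨k, hk, H⟩ := exists_concEnt_le
  have i1 := H (2 * (l * c) / N) (by positivity) (by
    rw [div_le_one hpos, hN]
    nlinarith [sq_nonneg (l - c), sq_nonneg a, sq_nonneg b, sq_nonneg d])
  have i2 := H (2 * (l * b) / N) (by positivity) (by
    rw [div_le_one hpos, hN]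
    nlinarith [sq_nonneg (l - b), sq_nonneg a, sq_nonneg c, sq_nonneg d])
  have i3 := H (2 * m / N) (by positivity) (by
    rw [div_le_one hpos, hN]
    nlinarith [sq_nonneg (b - c), sq_nonneg (a - d), sq_nonneg l])
  have hsum : (2 * (l * c) / N) ^ 2 + (2 * (l * b) / N) ^ 2 + (2 * m / N) ^ 2 =
      4 * ((l * c) ^ 2 + (l * b) ^ 2 + m ^ 2) / N ^ 2 := by
    field_simp
    ring
  have hs1 : (2 * (l * c) / N) ^ 2 + (2 * (l * b) / N) ^ 2 + (2 * m / N) ^ 2 ≤ 4 / 3 := by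
    rw [hsum, div_le_iff₀ (by positivity)]
    linarith
  have e1 : k * ((2 * (l * c) / N) ^ 2 + (2 * (l * b) / N) ^ 2 + (2 * m / N) ^ 2) ≤
      k * (4 / 3) := mul_le_mul_of_nonneg_left hs1 hk.le
  rw [← mul_add, ← mul_add, cMax_eq]
  constructor
  · apply mul_le_mul_of_nonneg_left _ hpos.le
    linarith
  · intro he
    have he' := mul_left_cancel₀ hpos.ne' he
    have : k * (4 / 3) ≤
        k * ((2 * (l * c) / N) ^ 2 + (2 * (l * b) / N) ^ 2 + (2 * m / N) ^ 2) := by linarith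
    have := le_of_mul_le_mul_left this hk
    rw [hsum, le_div_iff₀ (by positivity)] at this
    exact hW (heq (by linarith))

theorem exists_hasDecomp3 (ψ : Ket3) :
    ∃ e, HasDecomp3 (ketbra ψ) e ∧ e ≤ nsq ψ * cMax ∧ (e = nsq ψ * cMax → WLike ψ) := by
  obtain ⟨U, V, W, h1, h2, h3⟩ := exists_canonical ψ
  obtain ⟨e, he, hle, heq⟩ := hasDecomp3_canonical h1 h2 h3
  rw [nsq_act] at hle heq
  refine ⟨e, ?_, hle, fun h => (heq h).of_act⟩
  have := he.act U⁻¹ V⁻¹ W⁻¹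
  rwa [act_inv_act] at this

theorem hasDecomp3_ketbra (ψ : Ket3) : HasDecomp3 (ketbra ψ) (nsq ψ * cMax) := by
  obtain ⟨e, ⟨e₁, e₂, e₃, h₁, h₂, h₃, h⟩, hle, -⟩ := exists_hasDecomp3 ψ
  exact ⟨e₁, e₂, e₃, h₁, h₂, h₃, h.trans hle⟩

theorem exists_hasDecomp3_lt {ψ : Ket3} (h : ¬ WLike ψ) :
    ∃ e < nsq ψ * cMax, HasDecomp3 (ketbra ψ) e := by
  obtain ⟨e, he, hle, heq⟩ := exists_hasDecomp3 ψ
  exact ⟨e, lt_of_le_of_ne hle fun h' => h (heq h'), he⟩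

/-! ### The W state -/

theorem inv_sqrt_three_sq : ((Real.sqrt 3 : ℂ))⁻¹ ^ 2 = 1 / 3 := by
  rw [inv_pow, ← Complex.ofReal_pow, Real.sq_sqrt (by norm_num)]
  norm_num

theorem det2_slice_ketW_one : det2 (slice ketW 1) = 0 := by
  simp [det2, slice, ketW_apply]

theorem det2_slice_ketW_zero : det2 (slice ketW 0) = -(1 / 3) := by
  simp only [det2, slice, ketW_apply]
  simp
  linear_combination inv_sqrt_three_sq

theorem polar2_slice_ketW : polar2 (slice ketW 0) (slice ketW 1) = 0 := by
  simp [polar2, slice, ketW_apply]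

/-- This bounds a single reduction, not just the sum of three, so that a gain in AB alone already
beats `cMax`. -/
theorem WLike.hasDecomp_redAB {ψ : Ket3} (h : WLike ψ) :
    HasDecomp (redAB (ketbra ψ)) (nsq ψ * concEnt (2 / 3)) := by
  have hN : nsq (slice ketW 0) + nsq (slice ketW 1) = 1 := by
    rw [← nsq_ketW, nsq_ket2, nsq_ket2, nsq_ket3]; simp only [slice]; ring
  obtain ⟨c, U, V, W, rfl⟩ := h
  rw [← act_smul, nsq_act]
  have h0 : det2 (slice (c • ketW) 1) = 0 := by
    have : slice (c • ketW) 1 = c • slice ketW 1 := rfl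
    rw [this, det2_smul, det2_slice_ketW_one, mul_zero]
  have h1 : ‖det2 (slice (c • ketW) 0)‖ = Complex.normSq c / 3 := by
    have : slice (c • ketW) 0 = c • slice ketW 0 := rfl
    rw [this, det2_smul, det2_slice_ketW_zero, Complex.normSq_eq_norm_sq]
    simp
    ring
  have h2 : nsq (slice (c • ketW) 0) + nsq (slice (c • ketW) 1) = nsq (c • ketW) := by
    rw [nsq_ket2, nsq_ket2, nsq_ket3]; simp only [slice]; ring
  have := hasDecomp_pair (v := slice (c • ketW) 0) h0
  rw [h2, h1, ← redAB_ketbra] at this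
  have key : HasDecomp (redAB (ketbra (c • ketW))) (nsq (c • ketW) * concEnt (2 / 3)) := by
    convert this using 1
    rw [nsq_smul, nsq_ketW, mul_one]
    rcases eq_or_ne (Complex.normSq c) 0 with hc | hc
    · simp [hc]
    · congr 2; field_simp
  have := key.conj U V
  rwa [← redAB_act] at this

theorem WLike.hasDecomp_redAC {ψ : Ket3} (h : WLike ψ) :
    HasDecomp (redAC (ketbra ψ)) (nsq ψ * concEnt (2 / 3)) := by
  have := h.permAC.hasDecomp_redAB
  rwa [nsq_permAC, ← redAC_ketbra] at this

theorem WLike.hasDecomp_redBC {ψ : Ket3} (h : WLike ψ) :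
    HasDecomp (redBC (ketbra ψ)) (nsq ψ * concEnt (2 / 3)) := by
  have := h.permBC.hasDecomp_redAB
  rwa [nsq_permBC, ← redBC_ketbra] at this

/-- Every ket of positive weight lies in the range of the reduction: its 11 entry vanishes and its
01 and 10 entries agree. Its concurrence is therefore quadratic, `2 |φ₀₁|²`, with mean fixed by the
01 diagonal entry, and the tangent line in `C` concludes. -/
theorem le_sum_of_decomposition_ketW {k : ℕ} {p : Fin k → ℝ} {φ : Fin k → Ket2}
    (hp : ∀ i, 0 ≤ p i) (hsum : ∑ i, p i = 1) (hφ : ∀ i, IsUnitKet (φ i))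
    (hdec : redAB (ketbra ketW) = ∑ i, (p i : ℂ) • ketbra (φ i)) :
    concEnt (2 / 3) ≤ ∑ i, p i * concEnt (2 * ‖det2 (φ i)‖) := by
  have entry : ∀ x y, redAB (ketbra ketW) x y =
      ∑ i, (p i : ℂ) * (φ i x * starRingEnd ℂ (φ i y)) := by
    intro x y
    rw [hdec, Matrix.sum_apply]
    simp [ketbra, Matrix.vecMulVec_apply]
  have w : ∀ x y, redAB (ketbra ketW) x y = slice ketW 0 x * starRingEnd ℂ (slice ketW 0 y) +
      slice ketW 1 x * starRingEnd ℂ (slice ketW 1 y) := by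
    intro x y
    rw [redAB_ketbra]
    simp [ketbra, Matrix.vecMulVec_apply]
  have h11 : ∑ i, p i * Complex.normSq (φ i (1, 1)) = 0 := by
    have := entry (1, 1) (1, 1)
    rw [w] at this
    simp only [Complex.mul_conj] at this
    simp [slice, ketW_apply] at this
    exact_mod_cast this.symm
  have h01 : ∑ i, p i * Complex.normSq (φ i (0, 1)) = 1 / 3 := by
    have := entry (0, 1) (0, 1)
    rw [w] at this
    simp only [Complex.mul_conj] at this
    simp [slice, ketW_apply] at this
    rw [one_div]
    apply Complex.ofReal_injective
    push_cast
    exact this.symm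
  have hdiff : ∑ i, p i * Complex.normSq (φ i (0, 1) - φ i (1, 0)) = 0 := by
    have e1 := entry (0, 1) (0, 1)
    have e2 := entry (0, 1) (1, 0)
    have e3 := entry (1, 0) (0, 1)
    have e4 := entry (1, 0) (1, 0)
    rw [w] at e1 e2 e3 e4
    simp [slice, ketW_apply] at e1 e2 e3 e4
    have : ((∑ i, p i * Complex.normSq (φ i (0, 1) - φ i (1, 0)) : ℝ) : ℂ) = 0 := by
      push_cast
      simp only [← Complex.mul_conj, map_sub]
      calc _ = ∑ i, (p i : ℂ) * (φ i (0, 1) * starRingEnd ℂ (φ i (0, 1))) -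
            ∑ i, (p i : ℂ) * (φ i (0, 1) * starRingEnd ℂ (φ i (1, 0))) -
            ∑ i, (p i : ℂ) * (φ i (1, 0) * starRingEnd ℂ (φ i (0, 1))) +
            ∑ i, (p i : ℂ) * (φ i (1, 0) * starRingEnd ℂ (φ i (1, 0))) := by
            rw [← Finset.sum_sub_distrib, ← Finset.sum_sub_distrib, ← Finset.sum_add_distrib]
            exact Finset.sum_congr rfl fun i _ => by ring
        _ = 0 := by rw [← e1, ← e2, ← e3, ← e4]; ring
    exact_mod_cast this
  rw [Finset.sum_eq_zero_iff_of_nonneg fun i _ =>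
    mul_nonneg (hp i) (Complex.normSq_nonneg _)] at h11 hdiff
  have hC : ∀ i, p i * (2 * ‖det2 (φ i)‖) = 2 * (p i * Complex.normSq (φ i (0, 1))) := by
    intro i
    rcases mul_eq_zero.1 (h11 i (Finset.mem_univ i)) with h0 | h0
    · simp [h0]
    rcases mul_eq_zero.1 (hdiff i (Finset.mem_univ i)) with h0' | h0'
    · simp [h0']
    have a1 := Complex.normSq_eq_zero.1 h0
    have a2 := sub_eq_zero.1 (Complex.normSq_eq_zero.1 h0')
    rw [det2, a1, ← a2, mul_zero, zero_sub, norm_neg, norm_mul, Complex.normSq_eq_norm_sq]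
    ring
  have hle : ∀ i, 2 * ‖det2 (φ i)‖ ≤ 1 := by
    intro i
    have hn := isUnitKet_iff.1 (hφ i)
    rw [nsq_ket2] at hn
    simp only [Complex.normSq_eq_norm_sq] at hn
    have := norm_sub_le (φ i (0, 0) * φ i (1, 1)) (φ i (0, 1) * φ i (1, 0))
    rw [norm_mul, norm_mul] at this
    rw [det2]
    nlinarith [sq_nonneg (‖φ i (0, 0)‖ - ‖φ i (1, 1)‖), sq_nonneg (‖φ i (0, 1)‖ - ‖φ i (1, 0)‖)]
  obtain ⟨k', H⟩ := exists_le_concEnt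
  have e0 : concEnt (2 / 3) =
      ∑ i, (p i * (concEnt (2 / 3) - k' * (2 / 3)) + k' * (p i * (2 * ‖det2 (φ i)‖))) := by
    simp only [hC]
    rw [Finset.sum_add_distrib, ← Finset.sum_mul, hsum, ← Finset.mul_sum, ← Finset.mul_sum, h01]
    ring
  rw [e0]
  refine Finset.sum_le_sum fun i _ => ?_
  have := mul_le_mul_of_nonneg_left (H _ (by positivity) (hle i)) (hp i)
  linarith

theorem mulVec_conjTranspose_cancel {n : Type*} [Fintype n] [DecidableEq n] {M σ τ : Matrix n n ℂ}
    (hM : Mᴴ * M = 1) (h : M * σ * Mᴴ = τ) : σ = Mᴴ * τ * M := by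
  rw [← h, ← mul_assoc, ← mul_assoc, hM, one_mul, mul_assoc, hM, mul_one]

theorem le_eoF_redAB {ψ : Ket3} (hψ : WLike ψ) (hn : nsq ψ = 1) :
    concEnt (2 / 3) ≤ EoF (redAB (ketbra ψ)) := by
  have hdec := hψ.hasDecomp_redAB
  obtain ⟨c, U, V, W, rfl⟩ := hψ
  have hc : Complex.normSq c = 1 := by
    rwa [nsq_smul, nsq_act, nsq_ketW, mul_one] at hn
  rw [ketbra_phase hc] at hdec ⊢
  -- Some decomposition must exist, since the infimum of an empty set of reals would be 0.
  obtain ⟨k₀, p₀, φ₀, h₀, -⟩ := hdec.exists_isPureDecomposition (by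
    rw [trace_redAB, trace_ketbra, nsq_act, nsq_ketW]; simp)
  refine le_csInf ⟨∑ i, p₀ i * pureEoF (φ₀ i), k₀, p₀, φ₀, h₀, rfl⟩ ?_
  rintro _ ⟨k, p, φ, ⟨hp, hsum, hφ, hσ⟩, rfl⟩
  rw [redAB_act] at hσ
  have e := mulVec_conjTranspose_cancel (conjTranspose_kronecker_mul_self U V) hσ
  have hM : ((U : Matrix (Fin 2) (Fin 2) ℂ) ⊗ₖ (V : Matrix (Fin 2) (Fin 2) ℂ))ᴴ =
      ((U⁻¹ : U2) : Matrix (Fin 2) (Fin 2) ℂ) ⊗ₖ ((V⁻¹ : U2) : Matrix (Fin 2) (Fin 2) ℂ) :=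
    Matrix.conjTranspose_kronecker _ _
  have hM' : (U : Matrix (Fin 2) (Fin 2) ℂ) ⊗ₖ (V : Matrix (Fin 2) (Fin 2) ℂ) =
      (((U⁻¹ : U2) : Matrix (Fin 2) (Fin 2) ℂ) ⊗ₖ ((V⁻¹ : U2) : Matrix (Fin 2) (Fin 2) ℂ))ᴴ := by
    rw [← hM, Matrix.conjTranspose_conjTranspose]
  rw [hM, hM', Finset.mul_sum, Finset.sum_mul] at e
  simp only [Matrix.mul_smul, Matrix.smul_mul, ← ketbra_mulVec] at e
  have := le_sum_of_decomposition_ketW hp hsum (fun i => isUnitKet_iff.2 (by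
    rw [nsq_kronecker_mulVec, isUnitKet_iff.1 (hφ i)])) e
  simp only [norm_det2_kronecker_mulVec] at this
  refine this.trans_eq (Finset.sum_congr rfl fun i _ => ?_)
  rw [pureEoF_eq (hφ i)]

theorem sumEoF_of_wLike {ψ : Ket3} (hψ : WLike ψ) (hn : nsq ψ = 1) :
    sumEoF (ketbra ψ) = cMax := by
  have ht : (ketbra ψ).trace = 1 := by rw [trace_ketbra, hn]; simp
  apply le_antisymm
  · have := (hasDecomp3_ketbra ψ).sumEoF_le ht
    rwa [hn, one_mul] at this
  · rw [cMax_eq, sumEoF, redAC_ketbra, redBC_ketbra]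
    have h1 := le_eoF_redAB hψ hn
    have h2 := le_eoF_redAB hψ.permAC (by rwa [nsq_permAC])
    have h3 := le_eoF_redAB hψ.permBC (by rwa [nsq_permBC])
    linarith

/-! ### Planes of kets equivalent to the W state -/

theorem polar2_kronecker_mulVec (U V : Matrix (Fin 2) (Fin 2) ℂ) (v w : Ket2) :
    polar2 ((U ⊗ₖ V) *ᵥ v) ((U ⊗ₖ V) *ᵥ w) = U.det * V.det * polar2 v w := by
  simp only [polar2, kronecker_mulVec_apply, Matrix.det_fin_two]
  ring

theorem polar2_add_smul (x y x' y' : ℂ) (v w : Ket2) :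
    polar2 (x • v + y • w) (x' • v + y' • w) =
      2 * x * x' * det2 v + (x * y' + y * x') * polar2 v w + 2 * y * y' * det2 w := by
  simp [det2, polar2]
  ring

theorem polar2_smul_smul (c : ℂ) (v w : Ket2) : polar2 (c • v) (c • w) = c ^ 2 * polar2 v w := by
  simp [polar2]
  ring

/-- The quadratic form of preconcurrences of a multiple of a W state has rank one. -/
theorem WLike.exists_form {χ : Ket3} (h : WLike χ) : ∃ k α γ : ℂ,
    det2 (slice χ 0) = k * α ^ 2 ∧ polar2 (slice χ 0) (slice χ 1) = 2 * k * α * γ ∧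
    det2 (slice χ 1) = k * γ ^ 2 ∧ Complex.normSq α + Complex.normSq γ = 1 ∧
    Complex.normSq k = (nsq χ / 3) ^ 2 := by
  obtain ⟨c, U, V, W, rfl⟩ := h
  have hs : ∀ i, slice (c • ThreeQubit.act U V W ketW) i =
    c • slice (ThreeQubit.act U V W ketW) i := fun i => rfl
  have hdet : ∀ U : U2, ‖(U : Matrix (Fin 2) (Fin 2) ℂ).det‖ = 1 :=
    fun U => CStarRing.norm_of_mem_unitary (Matrix.det_of_mem_unitary U.2)
  -- For W itself the form is `-x²/3`. Unitaries on A, B multiply it by determinants of modulus one,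
  -- and the one on C substitutes `W 0 0 * x + W 1 0 * y` for `x`.
  refine ⟨-(c ^ 2 * ((U : Matrix (Fin 2) (Fin 2) ℂ).det * (V : Matrix (Fin 2) (Fin 2) ℂ).det)) / 3,
    W 0 0, W 1 0, ?_, ?_, ?_, ?_, ?_⟩
  · rw [hs, slice_act, det2_smul, det2_add_smul, polar2_kronecker_mulVec, det2_kronecker_mulVec,
      det2_kronecker_mulVec, det2_slice_ketW_one, det2_slice_ketW_zero, polar2_slice_ketW]
    ring
  · rw [hs, hs, slice_act, slice_act, polar2_smul_smul, polar2_add_smul, polar2_kronecker_mulVec,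
      det2_kronecker_mulVec, det2_kronecker_mulVec, det2_slice_ketW_one, det2_slice_ketW_zero,
      polar2_slice_ketW]
    ring
  · rw [hs, slice_act, det2_smul, det2_add_smul, polar2_kronecker_mulVec, det2_kronecker_mulVec,
      det2_kronecker_mulVec, det2_slice_ketW_one, det2_slice_ketW_zero, polar2_slice_ketW]
    ring
  · have hW : star (W : Matrix (Fin 2) (Fin 2) ℂ) * W = 1 := Matrix.UnitaryGroup.star_mul_self W
    have h00 := congrFun (congrFun hW 0) 0
    simp [Matrix.mul_apply, Matrix.star_apply] at h00
    rw [← Complex.normSq_eq_conj_mul_self, ← Complex.normSq_eq_conj_mul_self] at h00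
    exact_mod_cast h00
  · rw [nsq_smul, nsq_act, nsq_ketW, Complex.normSq_eq_norm_sq, Complex.normSq_eq_norm_sq]
    simp [hdet]

theorem WLike.polar2_sq {χ : Ket3} (h : WLike χ) :
    polar2 (slice χ 0) (slice χ 1) ^ 2 = 4 * det2 (slice χ 0) * det2 (slice χ 1) := by
  obtain ⟨k, α, γ, h0, h1, h2, -, -⟩ := h.exists_form
  rw [h0, h1, h2]
  ring

theorem WLike.normSq_form {χ : Ket3} (h : WLike χ) :
    Complex.normSq (det2 (slice χ 0)) + Complex.normSq (det2 (slice χ 1)) +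
      Complex.normSq (polar2 (slice χ 0) (slice χ 1)) / 2 = (nsq χ / 3) ^ 2 := by
  obtain ⟨k, α, γ, h0, h1, h2, h3, h4⟩ := h.exists_form
  rw [h0, h1, h2, ← h4]
  simp only [map_mul, map_pow, Complex.normSq_ofNat]
  linear_combination Complex.normSq k * (Complex.normSq α + Complex.normSq γ + 1) * h3

theorem coeff_eq_of_forall {A B C D : ℂ}
    (h : ∀ z : ℂ, A * z + B * z ^ 2 + C * z ^ 3 + D * z ^ 4 = 0) : A = 0 ∧ B = 0 := by
  have h1 := h 1
  have h2 := h (-1)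
  have h3 := h 2
  have h4 := h (-2)
  constructor
  · linear_combination (2 / 3) * (h1 - h2) - (1 / 12) * (h3 - h4)
  · linear_combination (2 / 3) * (h1 + h2) - (1 / 24) * (h3 + h4)

/-- Coefficients of a pencil of quadratic forms of rank one and prescribed norm. -/
theorem pencil_coefficients {A₁ A₂ B₁ B₂ C₁ C₂ : ℂ} {m : ℝ}
    (hJ : ∀ z : ℂ, Complex.normSq (-1 + A₁ * z + A₂ * z ^ 2) + Complex.normSq (B₁ * z + B₂ * z ^ 2) +
      Complex.normSq (C₁ * z + C₂ * z ^ 2) / 2 = (1 + m * Complex.normSq z) ^ 2)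
    (hD : ∀ z : ℂ, (C₁ * z + C₂ * z ^ 2) ^ 2 =
      4 * (-1 + A₁ * z + A₂ * z ^ 2) * (B₁ * z + B₂ * z ^ 2)) :
    A₁ = 0 ∧ A₂ = 0 ∧ B₁ = 0 ∧ C₁ ^ 2 = -4 * B₂ ∧ Complex.normSq C₁ = 4 * m := by
  -- `hJ` is a polynomial identity in `z` and its conjugate. These sample points isolate the terms
  -- in `z`, `z²` and `|z|²`; the first two give `A₁ = A₂ = 0`, after which `hD` gives `B₁ = 0`.
  have r1 := hJ 1
  have r2 := hJ (-1)
  have r3 := hJ 2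
  have r4 := hJ (-2)
  have i1 := hJ Complex.I
  have i2 := hJ (-Complex.I)
  have i3 := hJ (2 * Complex.I)
  have i4 := hJ (-2 * Complex.I)
  have s1 := hJ (1 + Complex.I)
  have s2 := hJ (-1 - Complex.I)
  simp [Complex.normSq_apply, pow_two] at r1 r2 r3 r4 i1 i2 i3 i4 s1 s2
  have eA1r : A₁.re = 0 := by
    linear_combination (-1 / 24) * (8 * (r1 - r2) - (r3 - r4))
  have eA1i : A₁.im = 0 := by
    linear_combination (1 / 24) * (8 * (i1 - i2) - (i3 - i4))
  have hA1 : A₁ = 0 := Complex.ext eA1r eA1i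
  have eA2r : A₂.re = 0 := by
    linear_combination (-1 / 4) * ((16 * (r1 + r2) - (r3 + r4)) / 24 -
      (16 * (i1 + i2) - (i3 + i4)) / 24)
  have eX : (A₁.re ^ 2 + A₁.im ^ 2) + (B₁.re ^ 2 + B₁.im ^ 2) +
      (C₁.re ^ 2 + C₁.im ^ 2) / 2 = 2 * m := by
    linear_combination (1 / 2) * ((16 * (r1 + r2) - (r3 + r4)) / 24 +
      (16 * (i1 + i2) - (i3 + i4)) / 24)
  have eY : (A₂.re ^ 2 + A₂.im ^ 2) + (B₂.re ^ 2 + B₂.im ^ 2) +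
      (C₂.re ^ 2 + C₂.im ^ 2) / 2 = m ^ 2 := by
    linear_combination ((r3 + r4) - 4 * (r1 + r2)) / 24
  have eA2i : A₂.im = 0 := by
    linear_combination (1 / 4) * ((s1 + s2) / 2 - 2 * eX - 4 * eY)
  have hA2 : A₂ = 0 := Complex.ext eA2r eA2i
  obtain ⟨hB, hC⟩ := coeff_eq_of_forall (A := 4 * B₁) (B := C₁ ^ 2 + 4 * B₂) (C := 2 * C₁ * C₂)
    (D := C₂ ^ 2) fun z => by
      have := hD z
      rw [hA1, hA2] at this
      linear_combination this
  have hB1 : B₁ = 0 := by simpa using hB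
  refine ⟨hA1, hA2, hB1, by linear_combination hC, ?_⟩
  rw [hA1, hB1] at eX
  simp at eX
  rw [Complex.normSq_apply]
  linear_combination 2 * eX

theorem star_ketW_dotProduct (φ : Ket3) : star ketW ⬝ᵥ φ =
    (Real.sqrt 3 : ℂ)⁻¹ * (φ (0, 0, 1) + φ (0, 1, 0) + φ (1, 0, 0)) := by
  simp [dotProduct, Fintype.sum_prod_type, Fin.sum_univ_two, ketW_apply]
  ring

theorem nsq_add_smul {n : Type*} [Fintype n] {v w : n → ℂ} (h : star v ⬝ᵥ w = 0) (z : ℂ) :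
    nsq (v + z • w) = nsq v + Complex.normSq z * nsq w := by
  have h' : star w ⬝ᵥ v = 0 := by
    have := congrArg star h
    rwa [Matrix.star_dotProduct, star_star, star_zero] at this
  apply Complex.ofReal_injective
  push_cast
  rw [← star_dotProduct_self, ← star_dotProduct_self, ← star_dotProduct_self]
  simp [h, h', Complex.normSq_eq_conj_mul_self]
  ring

/-- Kets `φ` such that all combinations with the W state are locally equivalent to it. -/
structure WPartner (φ : Ket3) : Prop where
  orth : star ketW ⬝ᵥ φ = 0
  wLike : ∀ z : ℂ, WLike (ketW + z • φ)

theorem WPartner.permAC {φ : Ket3} (h : WPartner φ) : WPartner (permAC φ) := by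
  refine ⟨?_, fun z => ?_⟩
  · have := h.orth
    rw [star_ketW_dotProduct] at this ⊢
    rw [← this]; simp only [ThreeQubit.permAC]; ring
  · have := (h.wLike z).permAC
    rw [← permAC_ketW]
    exact this

theorem WPartner.permBC {φ : Ket3} (h : WPartner φ) : WPartner (permBC φ) := by
  refine ⟨?_, fun z => ?_⟩
  · have := h.orth
    rw [star_ketW_dotProduct] at this ⊢
    rw [← this]; simp only [ThreeQubit.permBC]; ring
  · have := (h.wLike z).permBC
    rw [← permBC_ketW]
    exact this

/-- The forms of `√3 W + z φ` have discriminant zero and prescribed norm for every `z`;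
`pencil_coefficients` compares coefficients. The factor `√3` makes the constant term `-1`. -/
theorem WPartner.constraints {φ : Ket3} (h : WPartner φ) :
    φ (0, 1, 0) + φ (1, 0, 0) = 0 ∧
    φ (0, 0, 0) * φ (1, 1, 0) = φ (0, 1, 0) * φ (1, 0, 0) ∧ φ (1, 1, 1) = 0 ∧
    (φ (1, 1, 0) - φ (1, 0, 1) - φ (0, 1, 1)) ^ 2 =
      4 * (φ (0, 1, 1) * φ (1, 0, 1) - φ (0, 0, 1) * φ (1, 1, 1)) ∧
    Complex.normSq (φ (1, 1, 0) - φ (1, 0, 1) - φ (0, 1, 1)) = 4 * (nsq φ / 3) := by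
  set r : ℂ := (Real.sqrt 3 : ℂ) with hr
  have hr2 : r ^ 2 = 3 := by rw [hr, ← Complex.ofReal_pow, Real.sq_sqrt (by norm_num)]; norm_num
  have hr0 : r ≠ 0 := fun h0 => by simp [h0] at hr2
  have hrn : Complex.normSq r = 3 := by
    rw [hr, Complex.normSq_ofReal, Real.mul_self_sqrt (by norm_num)]
  have hχ : ∀ z : ℂ, WLike (r • ketW + z • φ) := by
    intro z
    have := (h.wLike (r⁻¹ * z)).smul r
    rwa [smul_add, smul_smul, mul_inv_cancel_left₀ hr0] at this
  have horth : star (r • ketW) ⬝ᵥ φ = 0 := by simp [h.orth]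
  have hn : ∀ z : ℂ, nsq (r • ketW + z • φ) / 3 = 1 + nsq φ / 3 * Complex.normSq z := by
    intro z
    rw [nsq_add_smul horth, nsq_smul, nsq_ketW, hrn]
    ring
  have hW : ∀ a b c, (r • ketW) (a, b, c) =
      ((if (a, b, c) = ((0, 0, 1) : Idx) then 1 else 0) +
        (if (a, b, c) = ((0, 1, 0) : Idx) then 1 else 0) +
        (if (a, b, c) = ((1, 0, 0) : Idx) then 1 else 0)) := by
    intro a b c
    rw [Pi.smul_apply, ketW_apply, smul_eq_mul, ← mul_assoc]
    convert one_mul _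
    rw [hr]; push_cast; field_simp
  have d0 : ∀ z : ℂ, det2 (slice (r • ketW + z • φ) 0) = -1 + -(φ (0, 1, 0) + φ (1, 0, 0)) * z +
      (φ (0, 0, 0) * φ (1, 1, 0) - φ (0, 1, 0) * φ (1, 0, 0)) * z ^ 2 := by
    intro z
    simp only [det2, slice, Pi.add_apply, hW]
    simp
    ring
  have d1 : ∀ z : ℂ, det2 (slice (r • ketW + z • φ) 1) = φ (1, 1, 1) * z +
      (φ (0, 0, 1) * φ (1, 1, 1) - φ (0, 1, 1) * φ (1, 0, 1)) * z ^ 2 := by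
    intro z
    simp only [det2, slice, Pi.add_apply, hW]
    simp
    ring
  have dp : ∀ z : ℂ, polar2 (slice (r • ketW + z • φ) 0) (slice (r • ketW + z • φ) 1) =
      (φ (1, 1, 0) - φ (1, 0, 1) - φ (0, 1, 1)) * z +
      (φ (0, 0, 0) * φ (1, 1, 1) + φ (1, 1, 0) * φ (0, 0, 1) - φ (0, 1, 0) * φ (1, 0, 1) -
        φ (1, 0, 0) * φ (0, 1, 1)) * z ^ 2 := by
    intro z
    simp only [polar2, slice, Pi.add_apply, hW]
    simp
    ring
  obtain ⟨hA1, hA2, hB1, hC, hX⟩ := pencil_coefficients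
    (A₁ := -(φ (0, 1, 0) + φ (1, 0, 0)))
    (A₂ := φ (0, 0, 0) * φ (1, 1, 0) - φ (0, 1, 0) * φ (1, 0, 0)) (B₁ := φ (1, 1, 1))
    (B₂ := φ (0, 0, 1) * φ (1, 1, 1) - φ (0, 1, 1) * φ (1, 0, 1))
    (C₁ := φ (1, 1, 0) - φ (1, 0, 1) - φ (0, 1, 1))
    (C₂ := φ (0, 0, 0) * φ (1, 1, 1) + φ (1, 1, 0) * φ (0, 0, 1) - φ (0, 1, 0) * φ (1, 0, 1) -
        φ (1, 0, 0) * φ (0, 1, 1)) (m := nsq φ / 3)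
    (fun z => by rw [← d0, ← d1, ← dp, ← hn]; exact (hχ z).normSq_form)
    (fun z => by rw [← d0, ← d1, ← dp]; exact (hχ z).polar2_sq)
  exact ⟨neg_eq_zero.1 hA1, sub_eq_zero.1 hA2, hB1, by linear_combination hC, hX⟩

/-- The constraints hold for all three pairs of qubits. The pairwise sums kill 001, 010, 100, and
the pairwise products of squared moduli at 011, 101, 110 all equal `(nsq φ / 3)²`. -/
theorem WPartner.structure {φ : Ket3} (h : WPartner φ) (hφ : φ ≠ 0) :
    φ (0, 0, 0) = 0 ∧ φ (0, 0, 1) = 0 ∧ φ (0, 1, 0) = 0 ∧ φ (1, 0, 0) = 0 ∧ φ (1, 1, 1) = 0 ∧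
    Complex.normSq (φ (1, 0, 1)) = Complex.normSq (φ (0, 1, 1)) ∧
    Complex.normSq (φ (1, 1, 0)) = Complex.normSq (φ (0, 1, 1)) ∧
    0 < Complex.normSq (φ (0, 1, 1)) ∧ φ (0, 1, 1) ≠ φ (1, 0, 1) := by
  have hm : 0 < nsq φ / 3 :=
    div_pos ((nsq_nonneg φ).lt_of_ne fun h0 => hφ (nsq_eq_zero.1 h0.symm)) (by norm_num)
  obtain ⟨a1, a2, a3, a4, a5⟩ := h.constraints
  obtain ⟨b1, b2, -, b4, b5⟩ := h.permAC.constraints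
  obtain ⟨c1, c2, -, c4, c5⟩ := h.permBC.constraints
  rw [nsq_permAC] at b5
  rw [nsq_permBC] at c5
  simp only [ThreeQubit.permAC, ThreeQubit.permBC] at b1 b2 b4 b5 c1 c2 c4 c5
  rw [a3] at a4 b4 c4
  have e1 : φ (0, 0, 1) = 0 := by linear_combination (1 / 2) * (b1 + c1 - a1)
  have e2 : φ (0, 1, 0) = 0 := by linear_combination (1 / 2) * (a1 + c1 - b1)
  have e3 : φ (1, 0, 0) = 0 := by linear_combination (1 / 2) * (a1 + b1 - c1)
  have key : ∀ x y z : ℂ, ∀ m : ℝ, x ^ 2 = 4 * (y * z) → Complex.normSq x = 4 * m →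
      Complex.normSq y * Complex.normSq z = m ^ 2 := by
    intro x y z m h1 h3
    have := congrArg Complex.normSq h1
    rw [map_pow, h3, map_mul, map_mul, Complex.normSq_ofNat] at this
    linear_combination (-1 / 16) * this
  have k1 := key _ (φ (0, 1, 1)) (φ (1, 0, 1)) _ (by linear_combination a4) a5
  have k2 := key _ (φ (0, 1, 1)) (φ (1, 1, 0)) _ (by linear_combination b4) b5
  have k3 := key _ (φ (1, 0, 1)) (φ (1, 1, 0)) _ (by linear_combination c4) c5
  have hm2 : 0 < (nsq φ / 3) ^ 2 := by positivity
  have q0 : Complex.normSq (φ (0, 1, 1)) ≠ 0 := fun h0 => by rw [h0, zero_mul] at k1; linarith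
  have r0 : Complex.normSq (φ (1, 0, 1)) ≠ 0 := fun h0 => by rw [h0, mul_zero] at k1; linarith
  have s0 : Complex.normSq (φ (1, 1, 0)) ≠ 0 := fun h0 => by rw [h0, mul_zero] at k2; linarith
  have hqr : Complex.normSq (φ (1, 0, 1)) = Complex.normSq (φ (0, 1, 1)) :=
    mul_right_cancel₀ s0 (k3.trans k2.symm)
  have hqs : Complex.normSq (φ (1, 1, 0)) = Complex.normSq (φ (0, 1, 1)) := by
    apply mul_right_cancel₀ r0
    rw [mul_comm, k3, k1]
  refine ⟨?_, e1, e2, e3, a3, hqr, hqs, (Complex.normSq_nonneg _).lt_of_ne q0.symm, ?_⟩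
  · rw [e2, zero_mul] at a2
    exact (mul_eq_zero.1 a2).resolve_right fun h0 => s0 (by rw [h0, map_zero])
  -- Equal entries would force the 110 entry to be 0 or four times the common value, against the
  -- equality of moduli.
  · intro hq
    have : φ (1, 1, 0) * (φ (1, 1, 0) - 4 * φ (0, 1, 1)) = 0 := by
      rw [← hq] at a4
      linear_combination a4
    rcases mul_eq_zero.1 this with h0 | h0
    · exact s0 (by rw [h0, map_zero])
    · rw [sub_eq_zero.1 h0, map_mul, Complex.normSq_ofNat] at hqs
      exact q0 (by linarith)

/-! ### Mixtures of kets equivalent to the W state -/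

theorem concEnt_zero : concEnt 0 = 0 := by
  simp [concEnt, h]

theorem ketbra_sqrt_smul {n : Type*} [Fintype n] {a : ℝ} (ha : 0 ≤ a) (v : n → ℂ) :
    ketbra ((Real.sqrt a : ℂ) • v) = (a : ℂ) • ketbra v := by
  rw [ketbra_smul, Complex.normSq_ofReal, Real.mul_self_sqrt ha]

theorem nsq_sqrt_smul {n : Type*} [Fintype n] {a : ℝ} (ha : 0 ≤ a) (v : n → ℂ) :
    nsq ((Real.sqrt a : ℂ) • v) = a * nsq v := by
  rw [nsq_smul, Complex.normSq_ofReal, Real.mul_self_sqrt ha]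

theorem norm_det2_sqrt_smul {a : ℝ} (ha : 0 ≤ a) (v : Ket2) :
    ‖det2 ((Real.sqrt a : ℂ) • v)‖ = a * ‖det2 v‖ := by
  rw [det2_smul, ← Complex.ofReal_pow, Real.sq_sqrt ha, norm_mul, Complex.norm_real,
    Real.norm_eq_abs, abs_of_nonneg ha]

theorem hasDecomp_product {a : ℝ} (ha : 0 ≤ a) {v : Ket2} (hv : det2 v = 0) :
    HasDecomp ((a : ℂ) • ketbra v) 0 := by
  have := HasDecomp.single ((Real.sqrt a : ℂ) • v)
  rwa [cost, norm_det2_sqrt_smul ha, hv, norm_zero, mul_zero, mul_zero, zero_div, concEnt_zero,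
    mul_zero, ketbra_sqrt_smul ha] at this

theorem hasDecomp_weighted_pair {a b : ℝ} (ha : 0 ≤ a) (hb : 0 ≤ b) {v w : Ket2}
    (hw : det2 w = 0) : HasDecomp ((a : ℂ) • ketbra v + (b : ℂ) • ketbra w)
      ((a * nsq v + b * nsq w) *
        concEnt (2 * (a * ‖det2 v‖) / (a * nsq v + b * nsq w))) := by
  have := hasDecomp_pair (v := (Real.sqrt a : ℂ) • v) (w := (Real.sqrt b : ℂ) • w)
    (by rw [det2_smul, hw, mul_zero])
  rwa [ketbra_sqrt_smul ha, ketbra_sqrt_smul hb, nsq_sqrt_smul ha, nsq_sqrt_smul hb,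
    norm_det2_sqrt_smul ha] at this

theorem norm_add_mul_conj_lt {P : ℝ} (hP : 0 < P) {q r : ℂ}
    (hqr : Complex.normSq r = Complex.normSq q) (hne : q ≠ r) :
    ‖(P : ℂ) + q * starRingEnd ℂ r‖ < P + Complex.normSq q := by
  have hQ := Complex.normSq_nonneg q
  apply lt_of_pow_lt_pow_left₀ 2 (by linarith)
  rw [← Complex.normSq_eq_norm_sq]
  have h1 : 0 < Complex.normSq (q - r) := Complex.normSq_pos.2 (sub_ne_zero.2 hne)
  rw [Complex.normSq_sub, hqr] at h1
  rw [Complex.normSq_add, Complex.normSq_ofReal, Complex.normSq_mul, Complex.normSq_conj, hqr]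
  have h2 : ((P : ℂ) * starRingEnd ℂ (q * starRingEnd ℂ r)).re =
      P * (q * starRingEnd ℂ r).re := by
    rw [Complex.re_ofReal_mul, Complex.conj_re]
  rw [h2]
  nlinarith

/-- The reduction has weights `P`, `Q` on `|00⟩`, `|11⟩` and a block on 01, 10 with diagonal `P + Q`
and off-diagonal modulus `κ`. Since the 011 and 101 entries of `φ` differ, `κ < P + Q`, so part of
the diagonal splits off as product kets of cost zero. -/
theorem exists_hasDecomp_redAB_lt {c : ℂ} (hc : c ≠ 0) {φ : Ket3} (h : WPartner φ) (hφ : φ ≠ 0) :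
    ∃ e < (nsq (c • ketW) + nsq φ) * concEnt (2 / 3),
      HasDecomp (redAB (ketbra (c • ketW) + ketbra φ)) e := by
  obtain ⟨p0, f1, f2, f3, t0, hr, hs, hQ, hne⟩ := h.structure hφ
  have hnφ : nsq φ = 3 * Complex.normSq (φ (0, 1, 1)) := by
    rw [nsq_ket3, p0, f1, f2, f3, t0, hr, hs]; simp; ring
  have hnW : nsq (c • ketW) = Complex.normSq c := by rw [nsq_smul, nsq_ketW, mul_one]
  have hP : 0 < Complex.normSq c / 3 := div_pos (Complex.normSq_pos.2 hc) (by norm_num)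
  set P := Complex.normSq c / 3 with hPdef
  set Q := Complex.normSq (φ (0, 1, 1)) with hQdef
  have hlt := norm_add_mul_conj_lt hP hr hne
  obtain ⟨u, hu, eu⟩ := exists_eq_norm_mul_phase
    ((P : ℂ) + φ (0, 1, 1) * starRingEnd ℂ (φ (1, 0, 1)))
  have hκ := norm_nonneg ((P : ℂ) + φ (0, 1, 1) * starRingEnd ℂ (φ (1, 0, 1)))
  set κ := ‖(P : ℂ) + φ (0, 1, 1) * starRingEnd ℂ (φ (1, 0, 1))‖
  have huc : starRingEnd ℂ u * u = 1 := by
    rw [← Complex.normSq_eq_conj_mul_self, hu]; simp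
  have hPQ : 0 < P + Q := add_pos hP hQ
  set m : Ket2 := Pi.single (0, 1) 1 + Pi.single (1, 0) (starRingEnd ℂ u) with hm
  have hmn : nsq m = 2 := by
    rw [nsq_ket2, hm]; simp [hu]; norm_num
  have hmd : ‖det2 m‖ = 1 := by
    have : ‖u‖ = 1 := by
      rw [Complex.normSq_eq_norm_sq] at hu
      nlinarith [norm_nonneg u]
    simp [det2, hm, this]
  have hes : ∀ i j : Fin 2, nsq (Pi.single (i, j) 1 : Ket2) = 1 := by
    intro i j
    rw [nsq, Finset.sum_eq_single (i, j)] <;> simp +contextual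
  have hed : ∀ i j : Fin 2, det2 (Pi.single (i, j) 1 : Ket2) = 0 := by
    intro i j
    fin_cases i <;> fin_cases j <;> simp [det2]
  -- The entangled part `κ • ketbra m` is shared between `|00⟩` and `|11⟩` in the ratio `P : Q`,
  -- which gives both pairs the concurrence `2κ/(P + Q + 2κ) < 2/3`.
  have D1 := hasDecomp_weighted_pair (a := κ * P / (P + Q)) (b := P) (by positivity) hP.le (v := m)
    (hed 0 0)
  have D2 := hasDecomp_weighted_pair (a := κ * Q / (P + Q)) (b := Q) (by positivity) hQ.le (v := m)
    (hed 1 1)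
  have D3 := hasDecomp_product (a := P + Q - κ) (by linarith) (hed 0 1)
  have D4 := hasDecomp_product (a := P + Q - κ) (by linarith) (hed 1 0)
  have D := ((D1.add D2).add D3).add D4
  rw [hmn, hmd, hes, hes] at D
  have C1 : 2 * (κ * P / (P + Q) * 1) / (κ * P / (P + Q) * 2 + P * 1) =
      2 * κ / (P + Q + 2 * κ) := by
    field_simp
    ring
  have C2 : 2 * (κ * Q / (P + Q) * 1) / (κ * Q / (P + Q) * 2 + Q * 1) =
      2 * κ / (P + Q + 2 * κ) := by
    field_simp
    ring
  have C3 : κ * P / (P + Q) * 2 + P * 1 + (κ * Q / (P + Q) * 2 + Q * 1) = P + Q + 2 * κ := by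
    field_simp
    ring
  rw [C1, C2, ← add_mul, C3, add_zero, add_zero] at D
  refine ⟨(P + Q + 2 * κ) * concEnt (2 * κ / (P + Q + 2 * κ)), ?_, ?_⟩
  · rw [hnW, hnφ]
    have l1 : concEnt (2 * κ / (P + Q + 2 * κ)) < concEnt (2 / 3) :=
      concEnt_lt (by positivity) (by rw [div_lt_iff₀ (by positivity)]; linarith)
    have l2 := concEnt_nonneg (2 * κ / (P + Q + 2 * κ))
    have l3 : Complex.normSq c + 3 * Q = 3 * (P + Q) := by rw [hPdef]; ring
    rw [l3]
    calc _ ≤ 3 * (P + Q) * concEnt (2 * κ / (P + Q + 2 * κ)) :=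
          mul_le_mul_of_nonneg_right (by linarith) l2
      _ < _ := mul_lt_mul_of_pos_left l1 (by positivity)
  · convert D using 1
    have hcc : c * (Real.sqrt 3 : ℂ)⁻¹ * (starRingEnd ℂ c * (Real.sqrt 3 : ℂ)⁻¹) = P := by
      have := inv_sqrt_three_sq
      rw [hPdef]; push_cast
      rw [← Complex.mul_conj]
      linear_combination c * starRingEnd ℂ c * this
    have hqq : φ (0, 1, 1) * starRingEnd ℂ (φ (0, 1, 1)) = Q := by rw [Complex.mul_conj]
    have hrr : φ (1, 0, 1) * starRingEnd ℂ (φ (1, 0, 1)) = Q := by rw [Complex.mul_conj, hr]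
    have hss : φ (1, 1, 0) * starRingEnd ℂ (φ (1, 1, 0)) = Q := by rw [Complex.mul_conj, hs]
    have eu' : (P : ℂ) + φ (1, 0, 1) * starRingEnd ℂ (φ (0, 1, 1)) =
        κ * starRingEnd ℂ u := by
      have := congrArg (starRingEnd ℂ) eu
      simp only [map_add, map_mul, Complex.conj_ofReal, Complex.conj_conj] at this
      linear_combination this
    have hsum : (κ * P / (P + Q) : ℂ) + κ * Q / (P + Q) = κ := by
      have : (P + Q : ℂ) ≠ 0 := by exact_mod_cast hPQ.ne'
      field_simp
    rw [redAB_add, redAB_ketbra, redAB_ketbra]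
    ext ⟨i, j⟩ ⟨k, l⟩
    fin_cases i <;> fin_cases j <;> fin_cases k <;> fin_cases l <;>
      simp [ketbra, Matrix.vecMulVec_apply, slice, ketW_apply, p0, f1, f2, f3, t0, hm,
        hcc, hqq, hrr, hss]
    · linear_combination -hsum
    · linear_combination eu - u * hsum
    · linear_combination eu' - starRingEnd ℂ u * hsum
    · linear_combination -hsum - (κ * P / (P + Q) + κ * Q / (P + Q)) * huc

/-- Mixtures of two orthogonal kets do not attain the bound. -/
theorem exists_hasDecomp3_add_lt {ψ χ : Ket3} (hψ : ψ ≠ 0) (hχ : χ ≠ 0) (horth : star ψ ⬝ᵥ χ = 0) :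
    ∃ e < (nsq ψ + nsq χ) * cMax, HasDecomp3 (ketbra ψ + ketbra χ) e := by
  -- If the plane is all of W type, AB alone gives the strict gain; otherwise a ket not of W type is
  -- completed to an orthogonal mixture of the pair.
  by_cases H : ∀ x y : ℂ, Complex.normSq x + Complex.normSq y = 1 → WLike (x • ψ + y • χ)
  · have hψW : WLike ψ := by simpa using H 1 0 (by simp)
    have hχW : WLike χ := by simpa using H 0 1 (by simp)
    have hall : ∀ z : ℂ, WLike (ψ + z • χ) := by
      intro z
      have hn : 0 < 1 + Complex.normSq z := by linarith [Complex.normSq_nonneg z]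
      set s : ℂ := (Real.sqrt (1 + Complex.normSq z) : ℂ)
      have hs : Complex.normSq s = 1 + Complex.normSq z := by
        rw [Complex.normSq_ofReal, Real.mul_self_sqrt hn.le]
      have hs0 : s ≠ 0 := fun h0 => by rw [h0, map_zero] at hs; linarith
      have := (H s⁻¹ (s⁻¹ * z) (by
        rw [map_mul, map_inv₀, hs]; field_simp)).smul s
      rwa [smul_add, smul_smul, smul_smul, mul_inv_cancel₀ hs0, mul_inv_cancel_left₀ hs0,
        one_smul] at this
    have h2 := hψW.hasDecomp_redAC.add hχW.hasDecomp_redAC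
    have h3 := hψW.hasDecomp_redBC.add hχW.hasDecomp_redBC
    rw [← redAC_add] at h2
    rw [← redBC_add] at h3
    obtain ⟨c, U, V, W, rfl⟩ := hψW
    have hc : c ≠ 0 := fun h0 => hψ (by rw [h0, zero_smul])
    set φ := act U⁻¹ V⁻¹ W⁻¹ χ with hφdef
    have hχφ : χ = act U V W φ := by
      have := act_inv_act U⁻¹ V⁻¹ W⁻¹ χ
      rw [inv_inv, inv_inv, inv_inv] at this
      exact this.symm
    have hφ : φ ≠ 0 := fun h0 => hχ (by rw [hχφ, h0, act_zero])
    have hpart : WPartner φ := by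
      refine ⟨?_, fun z => ?_⟩
      · rw [hχφ, ← act_smul, star_dotProduct_act] at horth
        simpa [hc] using horth
      · have := (hall (c * z)).smul c⁻¹
        rw [hχφ, smul_add, smul_smul, smul_smul, inv_mul_cancel₀ hc, inv_mul_cancel_left₀ hc,
          one_smul, ← act_smul, ← act_add] at this
        exact this.of_act
    obtain ⟨e, he, hdec⟩ := exists_hasDecomp_redAB_lt hc hpart hφ
    have h1 := hdec.redAB_act U V W
    rw [← hχφ, act_smul] at h1
    refine ⟨_, ?_, _, _, _, h1, h2, h3, le_rfl⟩
    have n1 : nsq (c • act U V W ketW) = nsq (c • ketW) := by rw [nsq_smul, nsq_smul, nsq_act]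
    have n2 : nsq χ = nsq φ := by rw [hφdef, nsq_act]
    rw [n1, n2, cMax_eq]
    linarith
  · push Not at H
    obtain ⟨x, y, hxy, hW⟩ := H
    have hmix := ketbra_add_ketbra_mix (rowUnitary x y hxy) ![ψ, χ]
    simp [rowUnitary] at hmix
    obtain ⟨e, he, hdec⟩ := exists_hasDecomp3_lt hW
    have h2 := hdec.add (hasDecomp3_ketbra (-(starRingEnd ℂ y • ψ) + starRingEnd ℂ x • χ))
    rw [hmix] at h2
    refine ⟨_, ?_, h2⟩
    have ht := congrArg Matrix.trace hmix
    rw [Matrix.trace_add, Matrix.trace_add, trace_ketbra, trace_ketbra, trace_ketbra,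
      trace_ketbra] at ht
    have ht' : nsq (x • ψ + y • χ) + nsq (-(starRingEnd ℂ y • ψ) + starRingEnd ℂ x • χ) =
      nsq ψ + nsq χ := by exact_mod_cast ht
    rw [← ht', add_mul]
    linarith

/-! ### The maximum over mixed states -/

theorem exists_spectral_kets {ρ : Matrix Idx Idx ℂ} (hρ : ρ.PosSemidef) :
    ∃ v : Idx → Ket3, ρ = ∑ i, ketbra (v i) ∧ ∀ i j, i ≠ j → star (v i) ⬝ᵥ v j = 0 := by
  have hH := hρ.isHermitian
  refine ⟨fun i => (Real.sqrt (hH.eigenvalues i) : ℂ) • (hH.eigenvectorBasis i).ofLp, ?_, ?_⟩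
  · simp only [ketbra_sqrt_smul (hρ.eigenvalues_nonneg _)]
    conv_lhs => rw [hH.spectral_theorem]
    ext a b
    simp [Matrix.sum_apply, ketbra, Matrix.vecMulVec_apply, Matrix.mul_apply,
      Matrix.diagonal_apply, Unitary.conjStarAlgAut_apply, Matrix.star_apply]
    exact Finset.sum_congr rfl fun i _ => by ring
  · intro i j hij
    have : inner ℂ (hH.eigenvectorBasis i) (hH.eigenvectorBasis j) = 0 :=
      hH.eigenvectorBasis.orthonormal.2 hij
    rw [EuclideanSpace.inner_eq_star_dotProduct, dotProduct_comm] at this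
    simp [this]

theorem sumEoF_le_cMax {ρ : Matrix Idx Idx ℂ} (hρ : IsDensity ρ) : sumEoF ρ ≤ cMax := by
  obtain ⟨v, hv, -⟩ := exists_spectral_kets hρ.1
  have h := HasDecomp3.sum Finset.univ (fun i => ketbra (v i)) _ fun i _ => hasDecomp3_ketbra (v i)
  rw [← hv, ← Finset.sum_mul] at h
  have ht := hρ.2
  rw [hv, Matrix.trace_sum] at ht
  simp only [trace_ketbra] at ht
  have ht' : ∑ i, nsq (v i) = 1 := by exact_mod_cast ht
  rw [ht', one_mul] at h
  exact h.sumEoF_le hρ.2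

theorem exists_wLike_of_sumEoF_eq {ρ : Matrix Idx Idx ℂ} (hρ : IsDensity ρ)
    (hmax : sumEoF ρ = cMax) : ∃ ψ, WLike ψ ∧ nsq ψ = 1 ∧ ρ = ketbra ψ := by
  classical
  obtain ⟨v, hv, horth⟩ := exists_spectral_kets hρ.1
  have ht := hρ.2
  rw [hv, Matrix.trace_sum] at ht
  simp only [trace_ketbra] at ht
  have ht' : ∑ i, nsq (v i) = 1 := by exact_mod_cast ht
  obtain ⟨i, hi⟩ : ∃ i, v i ≠ 0 := by
    by_contra! H
    simp [H, nsq] at ht'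
  -- A second nonzero eigenket would give a pair strictly below its share of `cMax`, and the
  -- remaining eigenkets cannot make up the loss.
  have hz : ∀ j, j ≠ i → v j = 0 := by
    intro j hj
    by_contra hj0
    obtain ⟨e, he, hdec⟩ := exists_hasDecomp3_add_lt hi hj0 (horth i j hj.symm)
    have hrest := HasDecomp3.sum ((Finset.univ.erase i).erase j) (fun i => ketbra (v i)) _
      fun i _ => hasDecomp3_ketbra (v i)
    have hjm : j ∈ Finset.univ.erase i := Finset.mem_erase.2 ⟨hj, Finset.mem_univ j⟩
    have hall := hdec.add hrest
    rw [add_assoc, Finset.add_sum_erase _ (fun i => ketbra (v i)) hjm,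
      Finset.add_sum_erase _ (fun i => ketbra (v i)) (Finset.mem_univ i), ← hv] at hall
    have := hall.sumEoF_le hρ.2
    rw [hmax, ← Finset.sum_mul] at this
    have e1 := Finset.add_sum_erase _ (fun i => nsq (v i)) hjm
    have e2 := Finset.add_sum_erase _ (fun i => nsq (v i)) (Finset.mem_univ i)
    rw [ht'] at e2
    have e3 : ∑ x ∈ (Finset.univ.erase i).erase j, nsq (v x) = 1 - nsq (v i) - nsq (v j) := by
      linarith
    rw [e3] at this
    linarith
  have hρv : ρ = ketbra (v i) := by
    rw [hv]
    refine Fintype.sum_eq_single i fun j hj => ?_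
    rw [hz j hj]
    ext; simp [ketbra]
  have hn : nsq (v i) = 1 := by
    have := Fintype.sum_eq_single (f := fun i => nsq (v i)) i fun j hj => by simp [hz j hj, nsq]
    rw [← this, ht']
  refine ⟨v i, ?_, hn, hρv⟩
  by_contra hW
  obtain ⟨e, he, hdec⟩ := exists_hasDecomp3_lt hW
  rw [← hρv] at hdec
  have := hdec.sumEoF_le hρ.2
  rw [hmax] at this
  rw [hn, one_mul] at he
  linarith

theorem wLike_ketW : WLike ketW := ⟨1, 1, 1, 1, by simp [act, localU_one]⟩

theorem isDensity_ketbra {ψ : Ket3} (hn : nsq ψ = 1) : IsDensity (ketbra ψ) :=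
  ⟨Matrix.posSemidef_vecMulVec_self_star ψ, by rw [trace_ketbra, hn]; simp⟩

end ThreeQubit

end

open ThreeQubit in
theorem theorem3 :
    IsGreatest (ThreeQubit.sumEoF '' {ρ | ThreeQubit.IsDensity ρ}) ThreeQubit.cMax ∧
      ∀ ρ : Matrix ThreeQubit.Idx ThreeQubit.Idx ℂ, ThreeQubit.IsDensity ρ →
        (ThreeQubit.sumEoF ρ = ThreeQubit.cMax ↔
          ThreeQubit.LocalUnitaryEquiv (ThreeQubit.ketbra ThreeQubit.ketW) ρ) := by
  refine ⟨⟨⟨ketbra ketW, isDensity_ketbra nsq_ketW, sumEoF_of_wLike wLike_ketW nsq_ketW⟩, ?_⟩,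
    fun ρ hρ => ⟨fun hmax => ?_, ?_⟩⟩
  · rintro _ ⟨ρ, hρ, rfl⟩
    exact sumEoF_le_cMax hρ
  · obtain ⟨ψ, ⟨c, U, V, W, rfl⟩, hn, rfl⟩ := exists_wLike_of_sumEoF_eq hρ hmax
    have hc : Complex.normSq c = 1 := by
      rwa [nsq_smul, nsq_act, nsq_ketW, mul_one] at hn
    rw [ketbra_phase hc]
    exact ⟨U, V, W, ketbra_mulVec _ _⟩
  · rintro ⟨U, V, W, rfl⟩
    have : ketbra (act U V W ketW) = _ := ketbra_mulVec (localU U V W) ketW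
    rw [localU] at this
    rw [← this]
    exact sumEoF_of_wLike (wLike_ketW.act U V W) (by rw [nsq_act, nsq_ketW])
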